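/- Let $n\ge 1$ and $k\ge n+2$. Consider $k$ qubits $q_1,\dots,q_k$ on a line. Circuits are finite sequences of the gates $H$, $T=\mathrm{diag}(1,e^{i\pi/4})$ and $T^\dagger$ (on any qubit) and CNOT (on two neighbouring qubits $q_j,q_{j+1}$, in either orientation). The cost of a circuit is the vector (number of CNOT gates, number of $T$ and $T^\dagger$ gates, number of $H$ gates), and costs are compared componentwise. Let $C$ be any set of $n$ of these qubits (the controls), $q_t\notin C$ any target, put $C'=C\cup\{q_t\}$, and let $q_a\notin C'$ be any further qubit (the dirty ancilla). Let $\mathrm{MCX}$ be the operator on all $k$ qubits that applies $X$ to $q_t$ if all qubits of $C$ are in state $|1\rangle$ and is the identity otherwise; in particular, it acts trivially on the ancilla and on all idle qubits, whatever their state. Then: 1. There is a circuit on the $k$ qubits whose operator is exactly $\mathrm{MCX}$ (with no global phase omitted) and whose cost is at most $$(4k+8n-16,\; 16n-16,\; 8n+4).$$ 2. (Refined count.) Let $n_1$ be the number of qubits $q_j\in C'$ with $j<a-1$, let $n_2$ be the number of those with $j>a+1$, let $n_-=1$ if $q_{a-1}$ exists and lies in $C'$ and $n_-=0$ otherwise,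 and let $n_+=1$ if $q_{a+1}$ exists and lies in $C'$ and $n_+=0$ otherwise. Put $s=n_++n_-$ and $p=n_+n_-$. Then there is a circuit on the $k$ qubits whose operator is exactly $\mathrm{MCX}$ and whose cost is at most $$\begin{cases} \bigl(4k+8n-16-4(s-p),\;16n-16-8(s-p),\;8n+8-4(s-p)\bigr) & n_1>0,\ n_2>0,\\ \bigl(4k+8n-6-2(3s-p)-4n_+,\;16n-8(2s-p),\;8n+8-4(2s-p)\bigr) & n_1>0,\ n_2=0,\\ \bigl(4k+8n-6-2(3s-p)-4n_-,\;16n-8(2s-p),\;8n+8-4(2s-p)\bigr) & n_1=0,\ n_2>0,\\ (4,0,0) & n_1=n_2=0. \end{cases}$$ -/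

import Mathlib

open scoped Matrix

noncomputable section

namespace LNN

/-- Operators on a register of `k` qubits, as matrices in the computational basis
`|x₁ … x_k⟩`, `x : Fin k → Fin 2`. -/
abbrev Operator (k : ℕ) : Type := Matrix (Fin k → Fin 2) (Fin k → Fin 2) ℂ

/-- The Pauli operator `X`. -/
def pauliX : Matrix (Fin 2) (Fin 2) ℂ := !![0, 1; 1, 0]

/-- The Hadamard operator `H`. -/
def hadamard : Matrix (Fin 2) (Fin 2) ℂ :=
  ((1 / Real.sqrt 2 : ℝ) : ℂ) • !![1, 1; 1, -1]

/-- The operator `T = diag(1, e^{iπ/4})`. -/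
def opT : Matrix (Fin 2) (Fin 2) ℂ :=
  !![1, 0; 0, Complex.exp (Complex.I * (Real.pi / 4))]

/-- The multi-controlled single-qubit operator with control set `C` and target `t`:
`O` is applied to qubit `t` if all the qubits of `C` are in state `1`, the identity is
applied otherwise. All qubits other than `t` keep their basis state. -/
def multiControlled {k : ℕ} (O : Matrix (Fin 2) (Fin 2) ℂ) (C : Finset (Fin k)) (t : Fin k) :
    Operator k :=
  fun x y =>
    if ∀ j, j ≠ t → x j = y j then
      if ∀ c ∈ C, y c = 1 then O (x t) (y t) else (1 : Matrix (Fin 2) (Fin 2) ℂ) (x t) (y t)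
    else 0

/-- The multi-controlled Toffoli gate, acting as the identity on every qubit outside
`C ∪ {t}`, whatever the state of these qubits. -/
def mcx {k : ℕ} (C : Finset (Fin k)) (t : Fin k) : Operator k :=
  multiControlled pauliX C t

/-- The elementary gates on `k` linear-nearest-neighbour qubits: `H`, `T` and its inverse on
any qubit, and the CNOT on any two neighbouring qubits, in either orientation. -/
inductive Gate (k : ℕ) : Type
  | h (q : Fin k)
  | t (q : Fin k)
  | tInv (q : Fin k)
  | cnot (control target : Fin k)
      (neighbours : (control : ℕ) + 1 = target ∨ (target : ℕ) + 1 = control)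

/-- The operator that a gate applies to the register. -/
def Gate.toOperator {k : ℕ} : Gate k → Operator k
  | .h q => multiControlled hadamard ∅ q
  | .t q => multiControlled opT ∅ q
  | .tInv q => multiControlled opTᴴ ∅ q
  | .cnot c q _ => multiControlled pauliX {c} q

/-- Gate counts, in the order (CNOT, T, H). Counts are compared componentwise. -/
abbrev Cost : Type := Fin 3 → ℤ

/-- The cost of a single gate; `T` and its inverse both count as `T` gates. -/
def Gate.cost {k : ℕ} : Gate k → Cost
  | .cnot _ _ _ => ![1, 0, 0]
  | .t _ => ![0, 1, 0]
  | .tInv _ => ![0, 1, 0]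
  | .h _ => ![0, 0, 1]

/-- A circuit is a finite sequence of gates; the head of the list is applied first. -/
abbrev Circuit (k : ℕ) : Type := List (Gate k)

/-- The operator that a circuit applies to the register. -/
def Circuit.toOperator {k : ℕ} : Circuit k → Operator k
  | [] => 1
  | g :: gs => Circuit.toOperator gs * g.toOperator

/-- The total gate count of a circuit. -/
def Circuit.cost {k : ℕ} (c : Circuit k) : Cost := (c.map Gate.cost).sum

/-- `MCXWithin C t L`: the multi-controlled Toffoli gate with controls `C` and target `t` has an
exact implementation (as an equality of operators on the whole register, no global phase left
out) by a linear-nearest-neighbour circuit with gate count at most `L`. -/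
def MCXWithin {k : ℕ} (C : Finset (Fin k)) (t : Fin k) (L : Cost) : Prop :=
  ∃ c : Circuit k, Circuit.toOperator c = mcx C t ∧ Circuit.cost c ≤ L

/-- Number of qubits of `S` strictly above the upper neighbour of `a`. -/
def numAbove {k : ℕ} (S : Finset (Fin k)) (a : Fin k) : ℕ :=
  (S.filter fun q : Fin k => (q : ℕ) + 1 < a).card

/-- Number of qubits of `S` strictly below the lower neighbour of `a`. -/
def numBelow {k : ℕ} (S : Finset (Fin k)) (a : Fin k) : ℕ :=
  (S.filter fun q : Fin k => (a : ℕ) + 1 < q).card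

/-- `1` if the upper neighbour of `a` exists and belongs to `S`, and `0` otherwise. -/
def numMinus {k : ℕ} (S : Finset (Fin k)) (a : Fin k) : ℕ :=
  (S.filter fun q : Fin k => (q : ℕ) + 1 = a).card

/-- `1` if the lower neighbour of `a` exists and belongs to `S`, and `0` otherwise. -/
def numPlus {k : ℕ} (S : Finset (Fin k)) (a : Fin k) : ℕ :=
  (S.filter fun q : Fin k => (a : ℕ) + 1 = q).card

/-- The gate count when there are far qubits of the controls-target set on both sides of the
ancilla. -/
def costTwoSided (k n nPlus nMinus : ℤ) : Cost :=
  let s := nPlus + nMinus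
  let p := nPlus * nMinus
  ![4 * k + 8 * n - 16 - 4 * (s - p), 16 * n - 16 - 8 * (s - p), 8 * n + 8 - 4 * (s - p)]

/-- The gate count when there are far qubits of the controls-target set on one side of the
ancilla only; `nNear` is `1` if the neighbour of the ancilla on the opposite side belongs to the
controls-target set, and `nFar` is the same for the neighbour on the side of the far qubits. -/
def costOneSided (k n nNear nFar : ℤ) : Cost :=
  let s := nNear + nFar
  let p := nNear * nFar
  ![4 * k + 8 * n - 6 - 2 * (3 * s - p) - 4 * nNear, 16 * n - 8 * (2 * s - p),
    8 * n + 8 - 4 * (2 * s - p)]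

/-- The refined gate count. The order of the qubits may be reversed, so that the case
`n₁ = 0 < n₂` is the mirror image of the case `n₂ = 0 < n₁`. -/
def refinedCost (k n n₁ n₂ nPlus nMinus : ℕ) : Cost :=
  if 0 < n₁ ∧ 0 < n₂ then costTwoSided k n nPlus nMinus
  else if 0 < n₁ then costOneSided k n nPlus nMinus
  else if 0 < n₂ then costOneSided k n nMinus nPlus
  else ![4, 0, 0]

end LNN

end

noncomputable section

namespace LNN

/-! ### Operators acting on one qubit, controlled by the others -/

/-! Conjugation by `H` on the target turns the gate into `mcz S`, the sign change on the states with
all qubits of `S = C ∪ {t}` set. This operator is diagonal and symmetric in `S`, so the target is no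
longer special.

Split `S` into `A` and `B`, and let `U`, `W` act on an ancilla by two anticommuting Pauli operators,
controlled by `A` and by `B`. These are involutions, and `U W U W` is `-1` exactly when both are
active and `1` otherwise. It is therefore `mcz (A ∪ B)` and restores the ancilla whatever its state
(`Within.mcz_of_commutator`). Since `U` and `W` each occur twice, they need only be correct up to
signs depending on the other qubits, which allows cheap relative-phase gates.

Such a signed controlled `Z` is carried along the line by `exists_signedZ`. If a gate on one qubit
sends `Z` to `-Z` when the next qubit is set, conjugating by it turns a controlled `Z` on the first
qubit into one on the next, up to a sign. A CNOT merely moves the `Z`, for 2 CNOTs; a relative-phase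
Toffoli also collects the preceding qubit as a control, for cost (6,8,4).

A neighbour of the ancilla cannot be collected in this way. It enters the commutator either as a
CNOT onto the ancilla or through a controlled reflection permuting the Pauli operators up to sign.
The positions of the far and near qubits of `S` then give the refined cost.

For the unrefined bound the ancilla is chosen anew, at the first gap between qubits of `S`. If `S`
has no gap, an ancilla at its end would cost 4 CNOTs too many by the construction above;
`within_mcz_of_end` saves them. -/

/-- `F` does not depend on the coordinate `t`. -/
def IndepOf {k : ℕ} {β : Type*} (t : Fin k) (F : (Fin k → Fin 2) → β) : Prop :=
  ∀ y b, F (Function.update y t b) = F y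

/-- The operator that applies `F y` to the qubit `t` when the register is in the state `y`. -/
def blockOp {k : ℕ} (t : Fin k) (F : (Fin k → Fin 2) → Matrix (Fin 2) (Fin 2) ℂ) : Operator k :=
  fun x y => if ∀ j, j ≠ t → x j = y j then F y (x t) (y t) else 0

variable {k : ℕ}

theorem multiControlled_eq_blockOp (O : Matrix (Fin 2) (Fin 2) ℂ) (C : Finset (Fin k))
    (t : Fin k) :
    multiControlled O C t = blockOp t fun y => if ∀ c ∈ C, y c = 1 then O else 1 := by
  funext x y
  simp only [multiControlled, blockOp]
  split_ifs <;> rfl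

theorem eq_update_of_agree {t : Fin k} {x y : Fin k → Fin 2} (h : ∀ j, j ≠ t → x j = y j) :
    x = Function.update y t (x t) := by
  funext j
  by_cases hj : j = t
  · subst hj; simp
  · simp [hj, h j hj]

/-- The intermediate state differs from `y` only at `t`, so by independence the left factor still
applies `F y`. -/
theorem blockOp_mul {t : Fin k} {F : (Fin k → Fin 2) → Matrix (Fin 2) (Fin 2) ℂ}
    (hF : IndepOf t F) (G : (Fin k → Fin 2) → Matrix (Fin 2) (Fin 2) ℂ) :
    blockOp t F * blockOp t G = blockOp t fun y => F y * G y := by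
  ext x y
  rw [Matrix.mul_apply]
  have hinj : Function.Injective fun b : Fin 2 => Function.update y t b :=
    Function.update_injective y t
  have key : ∑ z, blockOp t F x z * blockOp t G z y =
      ∑ b : Fin 2, blockOp t F x (Function.update y t b) *
        blockOp t G (Function.update y t b) y := by
    rw [← Finset.sum_image (f := fun z => blockOp t F x z * blockOp t G z y)
      (s := Finset.univ) (g := fun b : Fin 2 => Function.update y t b) (fun _ _ _ _ h => hinj h)]
    symm
    apply Finset.sum_subset (Finset.subset_univ _)
    intro z _ hz
    have : ¬ ∀ j, j ≠ t → z j = y j := fun h =>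
      hz (Finset.mem_image.2 ⟨z t, Finset.mem_univ _, (eq_update_of_agree h).symm⟩)
    simp [blockOp, this]
  rw [key]
  have h1 : ∀ b, (∀ j, j ≠ t → x j = Function.update y t b j) ↔ ∀ j, j ≠ t → x j = y j := by
    intro b
    refine forall_congr' fun j => forall_congr' fun hj => ?_
    simp [hj]
  have h2 : ∀ b, (∀ j, j ≠ t → Function.update y t b j = y j) ↔ True := by
    intro b
    simp +contextual
  by_cases h : ∀ j, j ≠ t → x j = y j
  · simp only [blockOp, h1, h2, if_pos h, if_true, hF y, Matrix.mul_apply, Function.update_self]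
  · simp only [blockOp, h1, if_neg h]
    simp

/-- The diagonal `δ` does not mention `t`: two block forms on different qubits with the same `δ` are
the same operator. This is what lets a controlled `Z` change its target. -/
theorem blockOp_diagonal (t : Fin k) {F : (Fin k → Fin 2) → Matrix (Fin 2) (Fin 2) ℂ}
    {δ : (Fin k → Fin 2) → ℂ}
    (h : ∀ y, F y = Matrix.diagonal fun b => δ (Function.update y t b)) :
    blockOp t F = Matrix.diagonal δ := by
  ext x y
  by_cases hxy : ∀ j, j ≠ t → x j = y j
  · rw [blockOp, if_pos hxy, h]
    have hx := eq_update_of_agree hxy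
    by_cases ht : x t = y t
    · have : x = y := by rw [hx, ht, Function.update_eq_self]
      subst this
      simp
    · have : x ≠ y := fun e => ht (by rw [e])
      simp [Matrix.diagonal_apply_ne, ht, this]
  · rw [blockOp, if_neg hxy, Matrix.diagonal_apply_ne]
    rintro rfl
    exact hxy fun _ _ => rfl

theorem blockOp_one (t : Fin k) : (blockOp t fun _ => 1) = (1 : Operator k) := by
  rw [blockOp_diagonal t (δ := fun _ => 1), Matrix.diagonal_one]
  intro y
  exact Matrix.diagonal_one.symm

theorem IndepOf.const {β : Type*} (t : Fin k) (b : β) : IndepOf t fun _ : Fin k → Fin 2 => b :=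
  fun _ _ => rfl

theorem IndepOf.comp₂ {β γ δ : Type*} {t : Fin k} {F : (Fin k → Fin 2) → β}
    {G : (Fin k → Fin 2) → γ} (hF : IndepOf t F) (hG : IndepOf t G) (f : β → γ → δ) :
    IndepOf t fun y => f (F y) (G y) := fun y b => by
  simp only [hF y b, hG y b]

theorem IndepOf.coord {β : Type*} {t c : Fin k} (h : c ≠ t) (f : Fin 2 → β) :
    IndepOf t fun y : Fin k → Fin 2 => f (y c) := fun y b => by
  simp [h]

/-! ### Circuits realising an operator within a cost -/

/-- `M` has an exact implementation with gate count at most `L`. -/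
def Within (M : Operator k) (L : Cost) : Prop :=
  ∃ c : Circuit k, Circuit.toOperator c = M ∧ Circuit.cost c ≤ L

theorem Circuit.toOperator_append (c d : Circuit k) :
    Circuit.toOperator (c ++ d) = Circuit.toOperator d * Circuit.toOperator c := by
  induction c with
  | nil => simp [Circuit.toOperator]
  | cons g c ih => simp [Circuit.toOperator, ih, Matrix.mul_assoc]

theorem Circuit.cost_append (c d : Circuit k) :
    Circuit.cost (c ++ d) = Circuit.cost c + Circuit.cost d := by
  simp [Circuit.cost]

theorem Within.mul {M N : Operator k} {L L' : Cost} (hM : Within M L) (hN : Within N L') :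
    Within (M * N) (L + L') := by
  obtain ⟨c, rfl, hc⟩ := hM
  obtain ⟨d, rfl, hd⟩ := hN
  refine ⟨d ++ c, Circuit.toOperator_append d c, ?_⟩
  rw [Circuit.cost_append, add_comm]
  exact add_le_add hc hd

theorem Within.mono {M : Operator k} {L L' : Cost} (hM : Within M L) (h : L ≤ L') :
    Within M L' := by
  obtain ⟨c, hc, hL⟩ := hM
  exact ⟨c, hc, hL.trans h⟩

theorem Within.gate (g : Gate k) : Within g.toOperator g.cost :=
  ⟨[g], by simp [Circuit.toOperator], by simp [Circuit.cost]⟩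

theorem Within.blockOp_mul {t : Fin k} {F G : (Fin k → Fin 2) → Matrix (Fin 2) (Fin 2) ℂ}
    {L L' : Cost} (hF : Within (blockOp t F) L) (hG : Within (blockOp t G) L')
    (h : IndepOf t F) : Within (blockOp t fun y => F y * G y) (L + L') := by
  rw [← LNN.blockOp_mul h]
  exact hF.mul hG

/-- Two qubits are neighbours on the line. -/
def Adj (a b : Fin k) : Prop := (a : ℕ) + 1 = b ∨ (b : ℕ) + 1 = a

theorem Adj.symm {a b : Fin k} (h : Adj a b) : Adj b a := Or.symm h

theorem Adj.ne {a b : Fin k} (h : Adj a b) : a ≠ b := by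
  rintro rfl
  rcases h with h | h <;> omega

theorem Within.hadamard (q : Fin k) : Within (blockOp q fun _ => hadamard) ![0, 0, 1] := by
  have := Within.gate (Gate.h q)
  simpa [Gate.toOperator, Gate.cost, multiControlled_eq_blockOp] using this

theorem Within.opT (q : Fin k) : Within (blockOp q fun _ => opT) ![0, 1, 0] := by
  have := Within.gate (Gate.t q)
  simpa [Gate.toOperator, Gate.cost, multiControlled_eq_blockOp] using this

theorem Within.opTInv (q : Fin k) : Within (blockOp q fun _ => LNN.opTᴴ) ![0, 1, 0] := by
  have := Within.gate (Gate.tInv q)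
  simpa [Gate.toOperator, Gate.cost, multiControlled_eq_blockOp] using this

theorem Within.cnot {c q : Fin k} (h : Adj c q) :
    Within (blockOp q fun y => if y c = 1 then pauliX else 1) ![1, 0, 0] := by
  have := Within.gate (Gate.cnot c q h)
  simpa [Gate.toOperator, Gate.cost, multiControlled_eq_blockOp] using this

/-! ### Single-qubit identities -/

/-- The Pauli operator `Z`. -/
def pauliZ : Matrix (Fin 2) (Fin 2) ℂ := !![1, 0; 0, -1]

/-- The Pauli operator `Y`. -/
def pauliY : Matrix (Fin 2) (Fin 2) ℂ := !![0, -Complex.I; Complex.I, 0]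

/-- The reflection `T X T†`, which exchanges `X` and `Y`. -/
def opE : Matrix (Fin 2) (Fin 2) ℂ := opT * pauliX * opTᴴ

/-- The reflection `H T X T† H`, which exchanges `Y` and `-Z`. -/
def opS : Matrix (Fin 2) (Fin 2) ℂ := hadamard * opE * hadamard

theorem hadamard_mul_self : hadamard * hadamard = 1 := by
  have h : ((Real.sqrt 2 : ℝ) : ℂ) * ((Real.sqrt 2 : ℝ) : ℂ) = 2 := by
    rw [← Complex.ofReal_mul]; norm_num
  have h0 : ((Real.sqrt 2 : ℝ) : ℂ) ≠ 0 := by simp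
  ext i j
  fin_cases i <;> fin_cases j <;> simp [hadamard, Matrix.mul_apply] <;> field_simp <;>
    linear_combination -h

theorem hadamard_mul_pauliX : hadamard * pauliX = pauliZ * hadamard := by
  ext i j
  fin_cases i <;> fin_cases j <;> simp [hadamard, pauliX, pauliZ, Matrix.mul_apply]

theorem hadamard_mul_pauliZ : hadamard * pauliZ = pauliX * hadamard := by
  ext i j
  fin_cases i <;> fin_cases j <;> simp [hadamard, pauliX, pauliZ, Matrix.mul_apply]

theorem hadamard_mul_pauliY : hadamard * pauliY = -pauliY * hadamard := by
  ext i j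
  fin_cases i <;> fin_cases j <;> simp [hadamard, pauliY, Matrix.mul_apply, mul_comm]

theorem exp_mul_conj :
    Complex.exp (Complex.I * (Real.pi / 4)) *
      (starRingEnd ℂ) (Complex.exp (Complex.I * (Real.pi / 4))) = 1 := by
  rw [← Complex.exp_conj, ← Complex.exp_add, Complex.exp_eq_one_iff]
  refine ⟨0, ?_⟩
  have h4 : (starRingEnd ℂ) 4 = 4 := Complex.conj_ofNat 4
  simp [h4]

theorem exp_mul_self :
    Complex.exp (Complex.I * (Real.pi / 4)) * Complex.exp (Complex.I * (Real.pi / 4)) =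
      Complex.I := by
  rw [← Complex.exp_add]
  convert Complex.exp_pi_div_two_mul_I using 2
  ring

theorem opE_eq : opE = !![0, (starRingEnd ℂ) (Complex.exp (Complex.I * (Real.pi / 4)));
    Complex.exp (Complex.I * (Real.pi / 4)), 0] := by
  ext i j
  fin_cases i <;> fin_cases j <;>
    simp [opE, opT, pauliX, Matrix.mul_apply, Matrix.conjTranspose_apply]

theorem opE_mul_self : opE * opE = 1 := by
  have h := exp_mul_conj
  rw [opE_eq]
  ext i j
  fin_cases i <;> fin_cases j <;> simp [-Complex.exp_conj, Matrix.mul_apply]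
  · rw [mul_comm]; exact h
  · exact h

theorem opE_mul_pauliX : opE * pauliX = pauliY * opE := by
  have h := exp_mul_conj
  have h1 := exp_mul_self
  rw [opE_eq]
  -- Only the relations `w * v = 1` and `w * w = I` are needed from here on.
  generalize Complex.exp (Complex.I * (Real.pi / 4)) = w at *
  generalize (starRingEnd ℂ) w = v at *
  ext i j
  fin_cases i <;> fin_cases j <;> simp [pauliX, pauliY, Matrix.mul_apply]
  · linear_combination (-Complex.I * w) * h + Complex.I * v * h1 + v * Complex.I_sq
  · rw [← h1]
    linear_combination -w * h

theorem opE_mul_pauliY : opE * pauliY = pauliX * opE := by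
  have h : pauliY = opE * pauliX * opE := by
    rw [opE_mul_pauliX, mul_assoc, opE_mul_self, mul_one]
  rw [h, ← mul_assoc, ← mul_assoc, opE_mul_self, one_mul]

theorem opE_mul_pauliZ : opE * pauliZ = -pauliZ * opE := by
  rw [opE_eq]
  ext i j
  fin_cases i <;> fin_cases j <;> simp [pauliZ, Matrix.mul_apply]

theorem pauliX_mul_self : pauliX * pauliX = 1 := by
  ext i j
  fin_cases i <;> fin_cases j <;> simp [pauliX, Matrix.mul_apply]

theorem pauliZ_mul_self : pauliZ * pauliZ = 1 := by
  ext i j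
  fin_cases i <;> fin_cases j <;> simp [pauliZ, Matrix.mul_apply]

theorem pauliX_mul_pauliZ : pauliX * pauliZ = -(pauliZ * pauliX) := by
  ext i j
  fin_cases i <;> fin_cases j <;> simp [pauliX, pauliZ, Matrix.mul_apply]

theorem hadamard_pauliX_hadamard : hadamard * pauliX * hadamard = pauliZ := by
  rw [hadamard_mul_pauliX, mul_assoc, hadamard_mul_self, mul_one]

theorem hadamard_pauliZ_hadamard : hadamard * pauliZ * hadamard = pauliX := by
  rw [hadamard_mul_pauliZ, mul_assoc, hadamard_mul_self, mul_one]

theorem opE_pauliX_opE : opE * pauliX * opE = pauliY := by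
  rw [opE_mul_pauliX, mul_assoc, opE_mul_self, mul_one]

theorem opE_pauliY_opE : opE * pauliY * opE = pauliX := by
  rw [opE_mul_pauliY, mul_assoc, opE_mul_self, mul_one]

theorem opE_pauliZ_opE : opE * pauliZ * opE = -pauliZ := by
  rw [opE_mul_pauliZ, mul_assoc, opE_mul_self, mul_one]

theorem opS_mul_self : opS * opS = 1 := by
  calc opS * opS = hadamard * opE * (hadamard * hadamard) * opE * hadamard := by
        simp only [opS, mul_assoc]
    _ = hadamard * (opE * opE) * hadamard := by rw [hadamard_mul_self]; simp only [mul_assoc, one_mul]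
    _ = 1 := by rw [opE_mul_self, mul_one, hadamard_mul_self]

theorem opS_mul_mul_opS (M : Matrix (Fin 2) (Fin 2) ℂ) :
    opS * M * opS = hadamard * (opE * (hadamard * M * hadamard) * opE) * hadamard := by
  simp only [opS, mul_assoc]

theorem opS_pauliX_opS : opS * pauliX * opS = -pauliX := by
  rw [opS_mul_mul_opS, hadamard_pauliX_hadamard, opE_pauliZ_opE, mul_neg, neg_mul,
    hadamard_pauliZ_hadamard]

theorem opS_pauliZ_opS : opS * pauliZ * opS = -pauliY := by
  rw [opS_mul_mul_opS, hadamard_pauliZ_hadamard, opE_pauliX_opE, hadamard_mul_pauliY, mul_assoc,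
    hadamard_mul_self, mul_one]

theorem opS_pauliY_opS : opS * pauliY * opS = -pauliZ := by
  rw [opS_mul_mul_opS, hadamard_mul_pauliY, mul_assoc (-pauliY), hadamard_mul_self, mul_one,
    mul_neg, neg_mul, opE_pauliY_opE, mul_neg, neg_mul, hadamard_pauliX_hadamard]

theorem pauliY_mul_self : pauliY * pauliY = 1 := by
  ext i j
  fin_cases i <;> fin_cases j <;> simp [pauliY, Matrix.mul_apply]

theorem pauliX_mul_pauliY : pauliX * pauliY = -(pauliY * pauliX) := by
  ext i j
  fin_cases i <;> fin_cases j <;> simp [pauliX, pauliY, Matrix.mul_apply]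

theorem pauliY_mul_pauliZ : pauliY * pauliZ = -(pauliZ * pauliY) := by
  ext i j
  fin_cases i <;> fin_cases j <;> simp [pauliY, pauliZ, Matrix.mul_apply]

/-! ### Independence -/

theorem IndepOf.of_dependsOn {β : Type*} {t : Fin k} {f : (Fin k → Fin 2) → β} {s : Set (Fin k)}
    (hf : DependsOn f s) (ht : t ∉ s) : IndepOf t f := fun y b => by
  apply hf
  intro i hi
  have : i ≠ t := fun e => ht (e ▸ hi)
  simp [this]

theorem IndepOf.forall_mem {t : Fin k} {A : Finset (Fin k)} (ht : t ∉ A) :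
    IndepOf t fun y : Fin k → Fin 2 => ∀ j ∈ A, y j = 1 := fun y b => by
  refine propext (forall_congr' fun j => forall_congr' fun hj => ?_)
  have : j ≠ t := fun e => ht (e ▸ hj)
  simp [this]

theorem IndepOf.ite {β : Type*} {t : Fin k} {P : (Fin k → Fin 2) → Prop} [DecidablePred P]
    (h : IndepOf t P) (a b : β) : IndepOf t fun y => if P y then a else b :=
  fun y c => by simp only [h y c]

/-! ### Conjugation -/

theorem Within.conj {t : Fin k} {F G : (Fin k → Fin 2) → Matrix (Fin 2) (Fin 2) ℂ}
    {L L' : Cost} (hF : Within (blockOp t F) L) (hG : Within (blockOp t G) L')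
    (iF : IndepOf t F) (iG : IndepOf t G) :
    Within (blockOp t fun y => G y * F y * G y) (L' + L + L') :=
  (hG.blockOp_mul hF iG).blockOp_mul hG (iG.comp₂ iF (· * ·))

theorem Within.congr {M N : Operator k} {L : Cost} (h : Within M L) (e : M = N) : Within N L :=
  e ▸ h

theorem Within.congr_blockOp {t : Fin k} {F G : (Fin k → Fin 2) → Matrix (Fin 2) (Fin 2) ℂ}
    {L : Cost} (h : Within (blockOp t F) L) (e : ∀ y, F y = G y) : Within (blockOp t G) L := by
  rwa [← funext e]

/-- Only the inner `X` has to be controlled: `T` and `T†` are applied unconditionally and cancel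
when the control is 0. -/
theorem Within.controlledE {c q : Fin k} (h : Adj c q) :
    Within (blockOp q fun y => if y c = 1 then opE else 1) ![1, 2, 0] := by
  have iX : IndepOf q fun y : Fin k → Fin 2 => if y c = 1 then pauliX else 1 :=
    .coord h.ne fun b => if b = 1 then pauliX else 1
  have := ((Within.opT q).blockOp_mul (Within.cnot h) (.const q _)).blockOp_mul (Within.opTInv q)
    (iX.comp₂ (G := fun _ => ()) (.const q _) fun M _ => LNN.opT * M)
  refine (this.congr_blockOp fun y => ?_).mono ?_
  · split_ifs
    · rfl
    · ext i j
      fin_cases i <;> fin_cases j <;>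
        simp [LNN.opT, Matrix.mul_apply, Matrix.conjTranspose_apply, exp_mul_conj,
          -Complex.exp_conj]
  · intro i; fin_cases i <;> simp

theorem Within.hadamard_conj {t : Fin k} {F : (Fin k → Fin 2) → Matrix (Fin 2) (Fin 2) ℂ}
    {L : Cost} (hF : Within (blockOp t F) L) (iF : IndepOf t F) :
    Within (blockOp t fun y => LNN.hadamard * F y * LNN.hadamard) (L + ![0, 0, 2]) :=
  (hF.conj (Within.hadamard t) iF (.const t _)).mono (by
    rw [add_comm (![0, 0, 1] : Cost), add_assoc]
    gcongr
    intro i; fin_cases i <;> simp)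

theorem Within.controlledS {c q : Fin k} (h : Adj c q) :
    Within (blockOp q fun y => if y c = 1 then opS else 1) ![1, 2, 2] := by
  have := (Within.controlledE h).hadamard_conj (.coord h.ne fun b => if b = 1 then opE else 1)
  refine (this.congr_blockOp fun y => ?_).mono ?_
  · split_ifs
    · rfl
    · rw [mul_one, hadamard_mul_self]
  · intro i; fin_cases i <;> simp

theorem Within.controlledZ {c q : Fin k} (h : Adj c q) :
    Within (blockOp q fun y => if y c = 1 then pauliZ else 1) ![1, 0, 2] := by
  have := (Within.cnot h).hadamard_conj (.coord h.ne fun b => if b = 1 then pauliX else 1)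
  refine (this.congr_blockOp fun y => ?_).mono ?_
  · split_ifs
    · exact hadamard_pauliX_hadamard
    · rw [mul_one, hadamard_mul_self]
  · intro i; fin_cases i <;> simp

/-! ### Chains of relative-phase Toffoli gates -/

/-- `p 0, …, p d` are distinct consecutive qubits on the line. -/
def IsPath (p : ℕ → Fin k) (d : ℕ) : Prop :=
  (∀ i < d, Adj (p i) (p (i + 1))) ∧ ∀ i ≤ d, ∀ j ≤ d, p i = p j → i = j

theorem IsPath.mono {p : ℕ → Fin k} {d e : ℕ} (h : IsPath p d) (hed : e ≤ d) : IsPath p e :=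
  ⟨fun i hi => h.1 i (by omega), fun i hi j hj => h.2 i (by omega) j (by omega)⟩

/-- The operator `Z` on `t` controlled by the qubits of `A`, with a sign `s`. -/
def signedZ (t : Fin k) (s : (Fin k → Fin 2) → ℂ) (A : Finset (Fin k)) : Operator k :=
  blockOp t fun y => s y • if ∀ j ∈ A, y j = 1 then pauliZ else 1

/-- Conjugating a controlled `Z` on `t` by a gate that maps `Z` to `-Z` when `u` is set yields a
controlled `Z` on `u`. -/
theorem blockOp_conj_eq {t u : Fin k} (htu : t ≠ u) {σ : (Fin k → Fin 2) → ℂ}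
    {α γ : (Fin k → Fin 2) → Prop} [DecidablePred α] [DecidablePred γ]
    {G : (Fin k → Fin 2) → Matrix (Fin 2) (Fin 2) ℂ}
    (hσ : IndepOf t σ) (hσ' : IndepOf u σ) (hα : IndepOf t α) (hα' : IndepOf u α)
    (hγ : IndepOf t γ) (hγ' : IndepOf u γ) (hG : ∀ y, G y * G y = 1)
    (hZ : ∀ y, G y * pauliZ * G y = if γ y ∧ y u = 1 then -pauliZ else pauliZ) :
    (blockOp t fun y => G y * (σ y • if α y then pauliZ else 1) * G y) =
      blockOp u fun y => (σ y * if α y ∧ y t = 1 then -1 else 1) •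
        if α y ∧ γ y then pauliZ else 1 := by
  rw [blockOp_diagonal t (δ := fun y => (σ y * if α y ∧ y t = 1 then -1 else 1) *
      if (α y ∧ γ y) ∧ y u = 1 then -1 else 1),
    blockOp_diagonal u (δ := fun y => (σ y * if α y ∧ y t = 1 then -1 else 1) *
      if (α y ∧ γ y) ∧ y u = 1 then -1 else 1)]
  · intro y
    ext i j
    simp only [hσ' y, hα' y, hγ' y, Function.update_self, Function.update_of_ne htu]
    by_cases h1 : α y <;> by_cases h2 : γ y <;> fin_cases i <;> fin_cases j <;>
      simp [h1, h2, pauliZ]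
  · intro y
    have e : G y * (σ y • if α y then pauliZ else 1) * G y =
        σ y • if α y then (if γ y ∧ y u = 1 then -pauliZ else pauliZ) else 1 := by
      rw [← hZ, Matrix.mul_smul, Matrix.smul_mul]
      split_ifs
      · rfl
      · rw [mul_one, hG]
    rw [e]
    ext i j
    simp only [hσ y, hα y, hγ y, Function.update_self, Function.update_of_ne htu.symm]
    by_cases h1 : α y <;> by_cases h2 : γ y <;> by_cases h3 : y u = 1 <;> fin_cases i <;>
      fin_cases j <;> simp [h1, h2, h3, pauliZ]

/-- The relative-phase Toffoli gate with the target between its controls, up to the basis of the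
target. -/
theorem Within.toffoli {b c q : Fin k} (hb : Adj b q) (hc : Adj c q) :
    Within (blockOp q fun y => LNN.hadamard * ((if y b = 1 then opE else 1) *
      (if y c = 1 then pauliX else 1) * (if y b = 1 then opE else 1)) * LNN.hadamard) ![3, 4, 2] := by
  have iE : IndepOf q fun y : Fin k → Fin 2 => if y b = 1 then opE else 1 :=
    .coord hb.ne fun x => if x = 1 then opE else 1
  have iX : IndepOf q fun y : Fin k → Fin 2 => if y c = 1 then pauliX else 1 :=
    .coord hc.ne fun x => if x = 1 then pauliX else 1
  refine (((Within.cnot hc).conj (Within.controlledE hb) iX iE).hadamard_conj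
    ((iE.comp₂ iX (· * ·)).comp₂ iE (· * ·))).mono ?_
  intro i; fin_cases i <;> simp

theorem toffoli_block_mul_self (P Q : Prop) [Decidable P] [Decidable Q] :
    hadamard * ((if P then opE else 1) * (if Q then pauliX else 1) * (if P then opE else 1)) *
      hadamard * (hadamard * ((if P then opE else 1) * (if Q then pauliX else 1) *
        (if P then opE else 1)) * hadamard) = 1 := by
  have h (M : Matrix (Fin 2) (Fin 2) ℂ) (hM : M * M = 1) :
      hadamard * M * hadamard * (hadamard * M * hadamard) = 1 := by
    calc _ = hadamard * M * (hadamard * hadamard) * M * hadamard := by simp only [mul_assoc]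
      _ = hadamard * (M * M) * hadamard := by
        rw [hadamard_mul_self]; simp only [mul_assoc, one_mul]
      _ = 1 := by rw [hM, mul_one, hadamard_mul_self]
  apply h
  split_ifs <;>
    simp [opE_pauliX_opE, pauliY_mul_self, opE_mul_self, pauliX_mul_self]

/-- With both controls set the block is `H Y H = -Y`, which anticommutes with `Z`. With only `Q` it
is `H X H = Z`, a relative phase that commutes with `Z`, and otherwise it is 1. -/
theorem toffoli_block_conj_pauliZ (P Q : Prop) [Decidable P] [Decidable Q] :
    hadamard * ((if P then opE else 1) * (if Q then pauliX else 1) * (if P then opE else 1)) *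
      hadamard * pauliZ * (hadamard * ((if P then opE else 1) * (if Q then pauliX else 1) *
        (if P then opE else 1)) * hadamard) = if P ∧ Q then -pauliZ else pauliZ := by
  have h (M : Matrix (Fin 2) (Fin 2) ℂ) :
      hadamard * M * hadamard * pauliZ * (hadamard * M * hadamard) =
        hadamard * (M * pauliX * M) * hadamard := by
    rw [← hadamard_pauliZ_hadamard]; simp only [mul_assoc]
  rw [h]
  by_cases hP : P <;> by_cases hQ : Q <;>
    simp [hP, hQ, opE_pauliX_opE, opE_mul_self, pauliX_mul_self, hadamard_pauliX_hadamard]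
  rw [mul_assoc pauliY, pauliX_mul_pauliY, mul_neg, ← mul_assoc pauliY, pauliY_mul_self, one_mul,
    mul_neg, neg_mul, hadamard_pauliX_hadamard]

/-- Induction along the path: the last qubit is reached by conjugating, on the last but one, by a
CNOT or by a relative-phase Toffoli. The qubit `p (d - 1)` is the target of that conjugation and
cannot be a control unless it is `p 0`, whence the condition on `j`. The support of `s` is tracked
so that `s` is known not to involve the next targets. -/
theorem exists_signedZ {p : ℕ → Fin k} {d : ℕ} (hd : 1 ≤ d) :
    IsPath p d → ∀ A : Finset (Fin k), p 0 ∈ A →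
      (∀ q ∈ A, ∃ j, (j + 2 ≤ d ∨ j = 0) ∧ p j = q) →
      ∃ s : (Fin k → Fin 2) → ℂ, (∀ y, s y * s y = 1) ∧ DependsOn s {q | ∃ j < d, p j = q} ∧
        Within (signedZ (p d) s A)
          ![2 * d + 4 * A.card - 5, 8 * A.card - 8, 4 * A.card - 2] := by
  induction d, hd using Nat.le_induction with
  | base =>
    intro hp A h0 hA
    have hA' : A = {p 0} := by
      ext q
      rw [Finset.mem_singleton]
      constructor
      · intro hq
        obtain ⟨j, hj, rfl⟩ := hA q hq
        rw [show j = 0 by omega]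
      · rintro rfl; exact h0
    subst hA'
    refine ⟨fun _ => 1, fun _ => by simp, fun _ _ _ => rfl, ?_⟩
    have := Within.controlledZ (hp.1 0 one_pos)
    refine (this.congr ?_).mono ?_
    · simp [signedZ]
    · intro i; fin_cases i <;> simp
  | succ d hd ih =>
    intro hp A h0 hA
    have hadj := hp.1 d (by omega)
    have hnot (B : Finset (Fin k)) (hB : ∀ q ∈ B, ∃ j < d, p j = q) :
        p d ∉ B ∧ p (d + 1) ∉ B := by
      constructor <;> intro h <;> obtain ⟨j, hj, e⟩ := hB _ h
      · have := hp.2 j (by omega) d (by omega) e; omega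
      · have := hp.2 j (by omega) (d + 1) (by omega) e; omega
    have hs1 : p d ∉ {q | ∃ j < d, p j = q} := by
      rintro ⟨j, hj, e⟩
      have := hp.2 j (by omega) d (by omega) e; omega
    have hs2 : p (d + 1) ∉ {q | ∃ j < d, p j = q} := by
      rintro ⟨j, hj, e⟩
      have := hp.2 j (by omega) (d + 1) (by omega) e; omega
    -- For `d = 1` the qubit `p (d - 1)` is `p 0`, which the base case already uses as a control.
    by_cases hc : 2 ≤ d ∧ p (d - 1) ∈ A
    · obtain ⟨hd2, hmem⟩ := hc
      have hprev : Adj (p (d - 1)) (p d) := by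
        have := hp.1 (d - 1) (by omega)
        rwa [show d - 1 + 1 = d by omega] at this
      have hprev' : p (d - 1) ≠ p (d + 1) := fun e => by
        have := hp.2 (d - 1) (by omega) (d + 1) (by omega) e; omega
      set B := A.erase (p (d - 1)) with hBdef
      have hB : ∀ q ∈ B, ∃ j, (j + 2 ≤ d ∨ j = 0) ∧ p j = q := by
        intro q hq
        obtain ⟨hne, hqA⟩ := Finset.mem_erase.1 hq
        obtain ⟨j, hj, rfl⟩ := hA q hqA
        refine ⟨j, ?_, rfl⟩
        have : j ≠ d - 1 := fun e => hne (by rw [e])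
        omega
      obtain ⟨hB1, hB2⟩ := hnot B fun q hq => by
        obtain ⟨j, hj, e⟩ := hB q hq
        exact ⟨j, by omega, e⟩
      obtain ⟨s, hs, hdep, hW⟩ := ih (hp.mono (by omega)) B
        (Finset.mem_erase.2 ⟨fun e => by
          have := hp.2 0 (by omega) (d - 1) (by omega) e; omega, h0⟩) hB
      have hcard : (B.card : ℤ) + 1 = A.card := by
        exact_mod_cast Finset.card_erase_add_one hmem
      have iE : IndepOf (p d) fun y : Fin k → Fin 2 => if y (p (d - 1)) = 1 then opE else 1 :=
        .coord hprev.ne fun x => if x = 1 then opE else 1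
      have iX : IndepOf (p d) fun y : Fin k → Fin 2 => if y (p (d + 1)) = 1 then pauliX else 1 :=
        .coord hadj.ne.symm fun x => if x = 1 then pauliX else 1
      have iZ : IndepOf (p d) fun y : Fin k → Fin 2 =>
          s y • if ∀ j ∈ B, y j = 1 then pauliZ else 1 :=
        (IndepOf.of_dependsOn hdep hs1).comp₂ ((IndepOf.forall_mem hB1).ite _ _) (· • ·)
      have hall (y : Fin k → Fin 2) :
          ((∀ j ∈ B, y j = 1) ∧ y (p (d - 1)) = 1) ↔ ∀ j ∈ A, y j = 1 := by
        rw [← Finset.insert_erase hmem, Finset.forall_mem_insert, and_comm]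
      refine ⟨fun y => s y * if (∀ j ∈ B, y j = 1) ∧ y (p d) = 1 then -1 else 1, fun y => ?_,
        ?_, ?_⟩
      · rw [mul_mul_mul_comm, hs]
        split_ifs <;> simp
      · intro x y hxy
        have h1 : (∀ j ∈ B, x j = 1) ↔ ∀ j ∈ B, y j = 1 := by
          refine forall_congr' fun j => forall_congr' fun hj => ?_
          obtain ⟨i, hi, rfl⟩ := hB j hj
          rw [hxy _ ⟨i, by omega, rfl⟩]
        simp only [h1, hxy (p d) ⟨d, by omega, rfl⟩,
          hdep fun i hi => hxy i (by obtain ⟨j, hj, e⟩ := hi; exact ⟨j, by omega, e⟩)]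
      -- Here `γ` is the new control `p (d - 1)`; the target `p d` of the Toffoli lies between its
      -- two controls, so every CNOT is between neighbours.
      · have key := blockOp_conj_eq hadj.ne (σ := s) (α := fun y => ∀ j ∈ B, y j = 1)
          (γ := fun y => y (p (d - 1)) = 1) (.of_dependsOn hdep hs1) (.of_dependsOn hdep hs2)
          (.forall_mem hB1) (.forall_mem hB2) (.coord hprev.ne (· = 1)) (.coord hprev' (· = 1))
          (fun y => toffoli_block_mul_self (y (p (d - 1)) = 1) (y (p (d + 1)) = 1))
          (fun y => toffoli_block_conj_pauliZ (y (p (d - 1)) = 1) (y (p (d + 1)) = 1))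
        have := hW.conj (Within.toffoli hprev hadj.symm) iZ
          (((IndepOf.const (p d) hadamard).comp₂ ((iE.comp₂ iX (· * ·)).comp₂ iE (· * ·))
            (· * ·)).comp₂ (IndepOf.const (p d) hadamard) (· * ·))
        refine (this.congr (key.trans ?_)).mono ?_
        · simp only [signedZ, hall]
        · rw [← hcard]
          intro i; fin_cases i <;> simp <;> linarith
    · have hB : ∀ q ∈ A, ∃ j, (j + 2 ≤ d ∨ j = 0) ∧ p j = q := by
        intro q hq
        obtain ⟨j, hj, rfl⟩ := hA q hq
        refine ⟨j, ?_, rfl⟩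
        by_contra hcon
        exact hc ⟨by omega, by rwa [show d - 1 = j by omega]⟩
      obtain ⟨hB1, hB2⟩ := hnot A fun q hq => by
        obtain ⟨j, hj, e⟩ := hB q hq
        exact ⟨j, by omega, e⟩
      obtain ⟨s, hs, hdep, hW⟩ := ih (hp.mono (by omega)) A h0 hB
      have iX : IndepOf (p d) fun y : Fin k → Fin 2 => if y (p (d + 1)) = 1 then pauliX else 1 :=
        .coord hadj.ne.symm fun x => if x = 1 then pauliX else 1
      have iZ : IndepOf (p d) fun y : Fin k → Fin 2 =>
          s y • if ∀ j ∈ A, y j = 1 then pauliZ else 1 :=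
        (IndepOf.of_dependsOn hdep hs1).comp₂ ((IndepOf.forall_mem hB1).ite _ _) (· • ·)
      refine ⟨fun y => s y * if (∀ j ∈ A, y j = 1) ∧ y (p d) = 1 then -1 else 1, fun y => ?_,
        ?_, ?_⟩
      · rw [mul_mul_mul_comm, hs]
        split_ifs <;> simp
      · intro x y hxy
        have h1 : (∀ j ∈ A, x j = 1) ↔ ∀ j ∈ A, y j = 1 := by
          refine forall_congr' fun j => forall_congr' fun hj => ?_
          obtain ⟨i, hi, rfl⟩ := hB j hj
          rw [hxy _ ⟨i, by omega, rfl⟩]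
        simp only [h1, hxy (p d) ⟨d, by omega, rfl⟩,
          hdep fun i hi => hxy i (by obtain ⟨j, hj, e⟩ := hi; exact ⟨j, by omega, e⟩)]
      -- No control to collect: `γ` is trivial and the conjugating gate is a CNOT, since `X Z X =
      -- -Z`.
      · have key := blockOp_conj_eq hadj.ne (σ := s) (α := fun y => ∀ j ∈ A, y j = 1)
          (γ := fun _ => True) (G := fun y => if y (p (d + 1)) = 1 then pauliX else 1)
          (.of_dependsOn hdep hs1) (.of_dependsOn hdep hs2)
          (.forall_mem hB1) (.forall_mem hB2) (.const _ _) (.const _ _)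
          (fun y => by split_ifs <;> simp [pauliX_mul_self])
          (fun y => by
            split_ifs with h1 h2 <;> simp_all
            rw [pauliX_mul_pauliZ, neg_mul, mul_assoc, pauliX_mul_self, mul_one])
        refine ((hW.conj (Within.cnot hadj.symm) iZ iX).congr (key.trans ?_)).mono ?_
        · simp only [signedZ, and_true]
        · intro i; fin_cases i <;> simp; linarith

/-! ### Multi-controlled `Z` from one ancilla -/

/-- The operator that changes the sign of the states in which all qubits of `S` are set. -/
def mcz (S : Finset (Fin k)) : Operator k :=
  Matrix.diagonal fun x => if ∀ j ∈ S, x j = 1 then -1 else 1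

theorem mcz_insert {C : Finset (Fin k)} {t : Fin k} (ht : t ∉ C) :
    mcz (insert t C) = blockOp t fun y => if ∀ c ∈ C, y c = 1 then pauliZ else 1 := by
  symm
  apply blockOp_diagonal
  intro y
  have h (b : Fin 2) : (∀ c ∈ C, Function.update y t b c = 1) ↔ ∀ c ∈ C, y c = 1 :=
    iff_of_eq (IndepOf.forall_mem ht y b)
  simp only [Finset.forall_mem_insert, Function.update_self, h]
  ext i j
  split_ifs <;> fin_cases i <;> fin_cases j <;> simp_all [pauliZ]

theorem Within.mcx {C : Finset (Fin k)} {t : Fin k} (ht : t ∉ C) {L : Cost}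
    (h : Within (mcz (insert t C)) L) : Within (LNN.mcx C t) (L + ![0, 0, 2]) := by
  rw [mcz_insert ht] at h
  refine (h.hadamard_conj ((IndepOf.forall_mem ht).ite _ _)).congr ?_
  rw [LNN.mcx, multiControlled_eq_blockOp]
  congr 1
  funext y
  split_ifs
  · exact hadamard_pauliZ_hadamard
  · rw [mul_one, hadamard_mul_self]

/-- By hypothesis the word `U W U W` is a scalar on the ancilla, hence a diagonal sign not depending
on it. -/
theorem Within.mcz_of_commutator {a : Fin k} {S : Finset (Fin k)}
    {U W : (Fin k → Fin 2) → Matrix (Fin 2) (Fin 2) ℂ} {L L' : Cost}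
    (hU : Within (blockOp a U) L) (hW : Within (blockOp a W) L') (iU : IndepOf a U)
    (iW : IndepOf a W) (ha : a ∉ S)
    (h : ∀ y, U y * W y * U y * W y = if ∀ j ∈ S, y j = 1 then -1 else 1) :
    Within (mcz S) (L + L' + L + L') := by
  refine ((((hU.blockOp_mul hW iU).blockOp_mul hU (iU.comp₂ iW (· * ·))).blockOp_mul hW
    ((iU.comp₂ iW (· * ·)).comp₂ iU (· * ·))).congr_blockOp h).congr ?_
  apply blockOp_diagonal
  intro y
  have h (b : Fin 2) : (∀ c ∈ S, Function.update y a b c = 1) ↔ ∀ c ∈ S, y c = 1 :=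
    iff_of_eq (IndepOf.forall_mem ha y b)
  simp only [h]
  split_ifs
  · ext i j; fin_cases i <;> fin_cases j <;> simp
  · exact Matrix.diagonal_one.symm

theorem smul_commutator {s r : ℂ} (hs : s * s = 1) (hr : r * r = 1)
    (M N : Matrix (Fin 2) (Fin 2) ℂ) :
    s • M * (r • N) * (s • M) * (r • N) = M * N * M * N := by
  simp only [Matrix.smul_mul, Matrix.mul_smul, smul_smul]
  rw [show r * (s * (r * s)) = (s * s) * (r * r) by ring, hs, hr, one_mul, one_smul]

theorem commutator_pauliZ_pauliX : pauliZ * pauliX * pauliZ * pauliX = -1 := by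
  rw [mul_assoc pauliZ, pauliX_mul_pauliZ, mul_neg, neg_mul, ← mul_assoc, pauliZ_mul_self, one_mul,
    pauliX_mul_self]

theorem commutator_pauliY_pauliX : pauliY * pauliX * pauliY * pauliX = -1 := by
  rw [mul_assoc pauliY, pauliX_mul_pauliY, mul_neg, neg_mul, ← mul_assoc, pauliY_mul_self, one_mul,
    pauliX_mul_self]

theorem commutator_pauliY_pauliZ : pauliY * pauliZ * pauliY * pauliZ = -1 := by
  rw [pauliY_mul_pauliZ, neg_mul, neg_mul, mul_assoc pauliZ, pauliY_mul_self, mul_one,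
    pauliZ_mul_self]

section Words
variable (α β l r : Prop) [Decidable α] [Decidable β] [Decidable l] [Decidable r]

theorem commutator_ite : (if α then pauliZ else 1) * (if β then pauliX else 1) *
    (if α then pauliZ else 1) * (if β then pauliX else 1) = if α ∧ β then -1 else 1 := by
  by_cases hα : α <;> by_cases hβ : β <;>
    simp [hα, hβ, commutator_pauliZ_pauliX, pauliZ_mul_self, pauliX_mul_self]

/-- Conjugation by `opE` turns `X` into `Y`. If `l` fails, both factors are powers of `X` and
commute; if it holds, `Y` meets `X`. -/
theorem commutator_ite_conj : (if l then opE else 1) * (if α then pauliX else 1) *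
    (if l then opE else 1) * (if β then pauliX else 1) * ((if l then opE else 1) *
    (if α then pauliX else 1) * (if l then opE else 1)) * (if β then pauliX else 1) =
      if l ∧ α ∧ β then -1 else 1 := by
  by_cases hl : l <;> by_cases hα : α <;> by_cases hβ : β <;>
    simp [hl, hα, hβ, opE_pauliX_opE, opE_mul_self, commutator_pauliY_pauliX, pauliX_mul_self,
      pauliY_mul_self]

/-- With `α` and `β` true, the two factors are `X` and `±X` if `l` fails, `Y` and `Y` if only `l`
holds, and `Y` and `-Z` if both `l` and `r` hold. Only the last pair anticommutes. -/
theorem commutator_ite_conj_conj : (if l then opE else 1) * (if α then pauliX else 1) *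
    (if l then opE else 1) * ((if r then opS else 1) * ((if l then opE else 1) *
    (if β then pauliX else 1) * (if l then opE else 1)) * (if r then opS else 1)) *
    ((if l then opE else 1) * (if α then pauliX else 1) * (if l then opE else 1)) *
    ((if r then opS else 1) * ((if l then opE else 1) * (if β then pauliX else 1) *
    (if l then opE else 1)) * (if r then opS else 1)) =
      if r ∧ l ∧ α ∧ β then -1 else 1 := by
  by_cases hl : l <;> by_cases hr : r <;> by_cases hα : α <;> by_cases hβ : β <;>
    simp [hα, hβ, hl, hr, opE_pauliX_opE, opE_mul_self, opS_mul_self, opS_pauliX_opS,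
      opS_pauliY_opS, commutator_pauliY_pauliZ, pauliX_mul_self, pauliY_mul_self, pauliZ_mul_self]

end Words

/-- There is a circuit of cost at most `L` for a `Z` on the ancilla `a` controlled by `A`, up to
signs depending on the other qubits. -/
def HasLadder (a : Fin k) (A : Finset (Fin k)) (L : Cost) : Prop :=
  a ∉ A ∧ ∃ s : (Fin k → Fin 2) → ℂ, (∀ y, s y * s y = 1) ∧ IndepOf a s ∧ Within (signedZ a s A) L

theorem indepOf_smul_ite {a : Fin k} {s : (Fin k → Fin 2) → ℂ} {A : Finset (Fin k)}
    (hs : IndepOf a s) (hA : a ∉ A) (M N : Matrix (Fin 2) (Fin 2) ℂ) :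
    IndepOf a fun y => s y • if ∀ j ∈ A, y j = 1 then M else N :=
  hs.comp₂ ((IndepOf.forall_mem hA).ite M N) (· • ·)

theorem Within.signedX {a : Fin k} {s : (Fin k → Fin 2) → ℂ} {A : Finset (Fin k)} {L : Cost}
    (h : Within (signedZ a s A) L) (hs : IndepOf a s) (hA : a ∉ A) :
    Within (blockOp a fun y => s y • if ∀ j ∈ A, y j = 1 then pauliX else 1)
      (L + ![0, 0, 2]) := by
  refine (h.hadamard_conj (indepOf_smul_ite hs hA _ _)).congr_blockOp fun y => ?_
  rw [Matrix.mul_smul, Matrix.smul_mul]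
  split_ifs
  · rw [hadamard_pauliZ_hadamard]
  · rw [mul_one, hadamard_mul_self]

theorem conj_smul (c : ℂ) (M N : Matrix (Fin 2) (Fin 2) ℂ) :
    M * (c • N) * M = c • (M * N * M) := by
  rw [Matrix.mul_smul, Matrix.smul_mul]

theorem IndepOf.controlled {c a : Fin k} (h : c ≠ a) (M N : Matrix (Fin 2) (Fin 2) ℂ) :
    IndepOf a fun y : Fin k → Fin 2 => if y c = 1 then M else N :=
  .coord h fun b => if b = 1 then M else N

theorem HasLadder.mcz_union {a : Fin k} {A B : Finset (Fin k)} {L L' : Cost}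
    (hA : HasLadder a A L) (hB : HasLadder a B L') :
    Within (mcz (A ∪ B)) (2 • L + 2 • L' + ![0, 0, 4]) := by
  obtain ⟨haA, s, hs, is, hU⟩ := hA
  obtain ⟨haB, r, hr, ir, hW⟩ := hB
  refine (hU.mcz_of_commutator (hW.signedX ir haB) (indepOf_smul_ite is haA _ _)
    (indepOf_smul_ite ir haB _ _) (by simp [haA, haB]) fun y => ?_).mono ?_
  · rw [smul_commutator (hs y) (hr y), commutator_ite]
    exact if_congr Finset.forall_mem_union.symm rfl rfl
  · intro i; fin_cases i <;> simp [Matrix.vecHead, Matrix.vecTail] <;> linarith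

theorem HasLadder.mcz_insert_union {a l : Fin k} {A B : Finset (Fin k)} {L L' : Cost}
    (hA : HasLadder a A L) (hB : HasLadder a B L') (hl : Adj l a) :
    Within (mcz (insert l (A ∪ B))) (2 • L + 2 • L' + ![4, 8, 8]) := by
  obtain ⟨haA, s, hs, is, hU⟩ := hA
  obtain ⟨haB, r, hr, ir, hW⟩ := hB
  have iU := indepOf_smul_ite is haA pauliX 1
  have iE := IndepOf.controlled hl.ne opE 1
  refine (((hU.signedX is haA).conj (Within.controlledE hl) iU iE).mcz_of_commutator
    (hW.signedX ir haB) ((iE.comp₂ iU (· * ·)).comp₂ iE (· * ·))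
    (indepOf_smul_ite ir haB _ _) (by simp [haA, haB, hl.ne.symm]) fun y => ?_).mono ?_
  · rw [conj_smul (s y), smul_commutator (hs y) (hr y), commutator_ite_conj]
    exact if_congr (by rw [Finset.forall_mem_insert, Finset.forall_mem_union]) rfl rfl
  · intro i; fin_cases i <;> simp [Matrix.vecHead, Matrix.vecTail] <;> linarith

theorem HasLadder.mcz_insert_insert_union {a l r : Fin k} {A B : Finset (Fin k)} {L L' : Cost}
    (hA : HasLadder a A L) (hB : HasLadder a B L') (hl : Adj l a) (hr : Adj r a) :
    Within (mcz (insert r (insert l (A ∪ B)))) (2 • L + 2 • L' + ![12, 24, 16]) := by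
  obtain ⟨haA, s, hs, is, hU⟩ := hA
  obtain ⟨haB, σ, hσ, iσ, hW⟩ := hB
  have iU := indepOf_smul_ite is haA pauliX 1
  have iW := indepOf_smul_ite iσ haB pauliX 1
  have iE := IndepOf.controlled hl.ne opE 1
  have iS := IndepOf.controlled hr.ne opS 1
  have iEW := (iE.comp₂ iW (· * ·)).comp₂ iE (· * ·)
  refine (((hU.signedX is haA).conj (Within.controlledE hl) iU iE).mcz_of_commutator
    (((hW.signedX iσ haB).conj (Within.controlledE hl) iW iE).conj (Within.controlledS hr) iEW iS)
    ((iE.comp₂ iU (· * ·)).comp₂ iE (· * ·))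
    ((iS.comp₂ iEW (· * ·)).comp₂ iS (· * ·))
    (by simp [haA, haB, hl.ne.symm, hr.ne.symm]) fun y => ?_).mono ?_
  · rw [conj_smul (s y), conj_smul (σ y), conj_smul (σ y), smul_commutator (hs y) (hσ y), commutator_ite_conj_conj]
    exact if_congr (by rw [Finset.forall_mem_insert, Finset.forall_mem_insert,
      Finset.forall_mem_union]) rfl rfl
  · intro i; fin_cases i <;> simp [Matrix.vecHead, Matrix.vecTail] <;> linarith

/-- A neighbour of the ancilla alone needs no ladder: a CNOT supplies the `X` that anticommutes with
the ladder's `Z`. -/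
theorem HasLadder.mcz_insert {a r : Fin k} {A : Finset (Fin k)} {L : Cost}
    (hA : HasLadder a A L) (hr : Adj r a) : Within (mcz (insert r A)) (2 • L + ![2, 0, 0]) := by
  obtain ⟨haA, s, hs, is, hU⟩ := hA
  refine (hU.mcz_of_commutator (Within.cnot hr) (indepOf_smul_ite is haA _ _)
    (IndepOf.controlled hr.ne pauliX 1) (by simp [haA, hr.ne.symm]) fun y => ?_).mono ?_
  -- The CNOT carries no sign; a trivial one is inserted to fit `smul_commutator`.
  · rw [← one_smul ℂ (if y r = 1 then pauliX else 1), smul_commutator (hs y) (one_mul 1),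
      commutator_ite]
    exact if_congr (by rw [Finset.forall_mem_insert, and_comm]) rfl rfl
  · intro i; fin_cases i <;> simp [Matrix.vecHead, Matrix.vecTail] <;> linarith

theorem HasLadder.mcz_insert_insert {a l r : Fin k} {A : Finset (Fin k)} {L : Cost}
    (hA : HasLadder a A L) (hl : Adj l a) (hr : Adj r a) :
    Within (mcz (insert r (insert l A))) (2 • L + ![6, 8, 4]) := by
  obtain ⟨haA, s, hs, is, hU⟩ := hA
  have iU := indepOf_smul_ite is haA pauliX 1
  have iE := IndepOf.controlled hl.ne opE 1
  refine (((hU.signedX is haA).conj (Within.controlledE hl) iU iE).mcz_of_commutator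
    (Within.cnot hr) ((iE.comp₂ iU (· * ·)).comp₂ iE (· * ·))
    (IndepOf.controlled hr.ne pauliX 1) (by simp [haA, hl.ne.symm, hr.ne.symm])
    fun y => ?_).mono ?_
  · rw [← one_smul ℂ (if y r = 1 then pauliX else 1), conj_smul (s y),
      smul_commutator (hs y) (one_mul 1), commutator_ite_conj]
    exact if_congr (by rw [Finset.forall_mem_insert, Finset.forall_mem_insert, and_comm, and_comm,
      and_rotate, and_rotate]) rfl rfl
  · intro i; fin_cases i <;> simp [Matrix.vecHead, Matrix.vecTail] <;> linarith

/-! ### An ancilla at the end of the line -/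

theorem mul_blockOp_apply (M : Operator k) (t : Fin k)
    (G : (Fin k → Fin 2) → Matrix (Fin 2) (Fin 2) ℂ) (x y : Fin k → Fin 2) :
    (M * blockOp t G) x y = ∑ b, M x (Function.update y t b) * G y b (y t) := by
  rw [Matrix.mul_apply]
  have hinj : Function.Injective fun b : Fin 2 => Function.update y t b :=
    Function.update_injective y t
  trans ∑ b : Fin 2, M x (Function.update y t b) * blockOp t G (Function.update y t b) y
  · rw [← Finset.sum_image (f := fun z => M x z * blockOp t G z y)
      (s := Finset.univ) (g := fun b : Fin 2 => Function.update y t b) (fun _ _ _ _ h => hinj h)]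
    symm
    apply Finset.sum_subset (Finset.subset_univ _)
    intro z _ hz
    have : ¬ ∀ j, j ≠ t → z j = y j := fun h =>
      hz (Finset.mem_image.2 ⟨z t, Finset.mem_univ _, (eq_update_of_agree h).symm⟩)
    simp [blockOp, this]
  · refine Finset.sum_congr rfl fun b _ => ?_
    have h : ∀ j, j ≠ t → Function.update y t b j = y j := fun j hj => by simp [hj]
    rw [blockOp, if_pos h, Function.update_self]

theorem blockOp_mul_blockOp_apply {t u : Fin k} (htu : t ≠ u)
    {F : (Fin k → Fin 2) → Matrix (Fin 2) (Fin 2) ℂ} (hF : IndepOf u F)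
    (G : (Fin k → Fin 2) → Matrix (Fin 2) (Fin 2) ℂ) (x y : Fin k → Fin 2) :
    (blockOp t F * blockOp u G) x y =
      if ∀ j, j ≠ t ∧ j ≠ u → x j = y j then F y (x t) (y t) * G y (x u) (y u) else 0 := by
  rw [mul_blockOp_apply, Finset.sum_eq_single (x u)]
  · have h : (∀ j, j ≠ t → x j = Function.update y u (x u) j) ↔
        ∀ j, j ≠ t ∧ j ≠ u → x j = y j := by
      refine forall_congr' fun j => ?_
      by_cases hj : j = u
      · subst hj; simp
      · simp [hj]
    simp only [blockOp, h, hF y, Function.update_of_ne htu, ite_mul, zero_mul]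
  · intro b _ hb
    have h : ¬ ∀ j, j ≠ t → x j = Function.update y u b j := fun h => hb (by
      have := h u htu.symm
      rw [Function.update_self] at this
      exact this.symm)
    rw [blockOp, if_neg h, zero_mul]
  · intro h; exact absurd (Finset.mem_univ _) h

theorem blockOp_comm {t u : Fin k} (htu : t ≠ u)
    {F G : (Fin k → Fin 2) → Matrix (Fin 2) (Fin 2) ℂ} (hF : IndepOf u F) (hG : IndepOf t G) :
    blockOp t F * blockOp u G = blockOp u G * blockOp t F := by
  ext x y
  rw [blockOp_mul_blockOp_apply htu hF, blockOp_mul_blockOp_apply htu.symm hG]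
  exact if_congr (forall_congr' fun j => by rw [and_comm]) (mul_comm _ _) rfl

theorem blockOp_eq_mcz {a : Fin k} {S : Finset (Fin k)} (ha : a ∉ S) :
    (blockOp a fun y => if ∀ j ∈ S, y j = 1 then -1 else 1) = mcz S := by
  apply blockOp_diagonal
  intro y
  have h (b : Fin 2) : (∀ c ∈ S, Function.update y a b c = 1) ↔ ∀ c ∈ S, y c = 1 :=
    iff_of_eq (IndepOf.forall_mem ha y b)
  simp only [h]
  split_ifs
  · ext i j; fin_cases i <;> fin_cases j <;> simp
  · exact Matrix.diagonal_one.symm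

/-- The operator permuting the basis states by `f`. -/
def permOp (f : (Fin k → Fin 2) → Fin k → Fin 2) : Operator k :=
  fun x y => if x = f y then 1 else 0

theorem permOp_mul (f g : (Fin k → Fin 2) → Fin k → Fin 2) :
    permOp f * permOp g = permOp (f ∘ g) := by
  ext x y
  simp [Matrix.mul_apply, permOp]

/-- The basis-state permutation flipping `t` when `P` holds. -/
def flip (t : Fin k) (P : (Fin k → Fin 2) → Prop) [DecidablePred P] (y : Fin k → Fin 2) :
    Fin k → Fin 2 :=
  Function.update y t (y t + if P y then 1 else 0)

theorem blockOp_eq_permOp (t : Fin k) (P : (Fin k → Fin 2) → Prop) [DecidablePred P] :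
    (blockOp t fun y => if P y then pauliX else 1) = permOp (flip t P) := by
  ext x y
  by_cases h : ∀ j, j ≠ t → x j = y j
  · have hx : x = flip t P y ↔ x t = y t + if P y then 1 else 0 := by
      constructor
      · rintro e; rw [e]; simp [flip]
      · intro e; rw [flip, ← e]; exact eq_update_of_agree h
    simp only [blockOp, if_pos h, permOp, hx]
    generalize x t = u
    generalize y t = v
    split_ifs <;> fin_cases u <;> fin_cases v <;> simp_all [pauliX]
  · have hx : x ≠ flip t P y := by
      rintro rfl
      exact h fun j hj => by simp [flip, hj]
    simp [blockOp, h, permOp, hx]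

/-- On the bits `(l, a)` the map "CNOT onto `a`, then CNOT onto `l`" is linear of order 3. The four
CNOTs on the left are its square, hence its inverse, and the word is a conjugation that moves the
flip from `a` to `l`. -/
theorem flip_comp_eq {l a : Fin k} (hla : l ≠ a) {P : (Fin k → Fin 2) → Prop} [DecidablePred P]
    (hl : IndepOf l P) (ha : IndepOf a P) :
    flip l (fun y => y a = 1) ∘ flip a (fun y => y l = 1) ∘ flip l (fun y => y a = 1) ∘
      flip a (fun y => y l = 1) ∘ flip a P ∘ flip l (fun y => y a = 1) ∘
        flip a (fun y => y l = 1) = flip l P := by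
  have key (u : Fin 2) [Decidable (u = 1)] : (if u = 1 then (1 : Fin 2) else 0) = u := by
    fin_cases u <;> simp
  funext y j
  by_cases hjl : j = l
  · subst hjl
    simp only [Function.comp, flip, Function.update_self, Function.update_of_ne hla,
      Function.update_of_ne hla.symm, hl _ _, ha _ _, key]
    generalize y j = u
    generalize y a = v
    by_cases hP : P y <;> simp only [hP, if_true, if_false] <;> revert u v <;> decide
  · by_cases hja : j = a
    · subst hja
      simp only [Function.comp, flip, Function.update_self, Function.update_of_ne hla,
        Function.update_of_ne hla.symm, hl _ _, ha _ _, key]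
      generalize y j = u
      generalize y l = v
      by_cases hP : P y <;> simp only [hP, if_true, if_false] <;> revert u v <;> decide
    · simp [flip, hjl, hja]

theorem commutator_ite_pauliZ (α μ c : Prop) [Decidable α] [Decidable μ] [Decidable c] :
    (if c then pauliZ else 1) * ((if μ then opS else 1) * (if α then pauliZ else 1) *
      (if μ then opS else 1)) * (if c then pauliZ else 1) * ((if μ then opS else 1) *
      (if α then pauliZ else 1) * (if μ then opS else 1)) = if c ∧ μ ∧ α then -1 else 1 := by
  have h : pauliZ * pauliY * pauliZ * pauliY = -1 := by
    rw [mul_assoc pauliZ, pauliY_mul_pauliZ, mul_neg, neg_mul, ← mul_assoc, pauliZ_mul_self,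
      one_mul, pauliY_mul_self]
  by_cases hα : α <;> by_cases hμ : μ <;> by_cases hc : c <;>
    simp [hα, hμ, hc, opS_pauliZ_opS, opS_mul_self, pauliZ_mul_self, pauliY_mul_self, h]

/-- The ladder stops at `l`, one qubit short of the ancilla `a`, and `m` is included by conjugating
with `opS`, which sends `Z` to `-Y`. The commutator `c₁ Q c₁ Q` is then an `X` on `a` controlled by
`m` and `A`; conjugation by CNOTs moves it to `l`, and `H` makes it a `Z`. One pair of CNOTs
cancels, leaving six beyond those in the two copies of `Q`. -/
theorem within_mcz_of_end {l a m : Fin k} {A : Finset (Fin k)} {s : (Fin k → Fin 2) → ℂ}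
    {L : Cost} (hla : Adj l a) (hml : Adj m l) (hma : m ≠ a) (hlA : l ∉ A) (haA : a ∉ A)
    (hs : ∀ y, s y * s y = 1) (hsl : IndepOf l s) (hsa : IndepOf a s)
    (h : Within (signedZ l s A) L) :
    Within (mcz (insert l (insert m A))) (2 • L + ![10, 8, 10]) := by
  set q : (Fin k → Fin 2) → Matrix (Fin 2) (Fin 2) ℂ := fun y =>
    (if y m = 1 then opS else 1) * (s y • if ∀ j ∈ A, y j = 1 then pauliZ else 1) *
      (if y m = 1 then opS else 1) with hq
  have iq (t : Fin k) (hmt : m ≠ t) (hst : IndepOf t s) (htA : t ∉ A) : IndepOf t q :=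
    ((IndepOf.controlled hmt opS 1).comp₂ (indepOf_smul_ite hst htA pauliZ 1) (· * ·)).comp₂
      (IndepOf.controlled hmt opS 1) (· * ·)
  have hlS : l ∉ insert m A := by simp [hlA, hml.ne.symm]
  have haS : a ∉ insert m A := by simp [haA, hma.symm]
  have wQ : Within (blockOp l q) (L + ![2, 4, 4]) := by
    refine (h.conj (Within.controlledS hml) (indepOf_smul_ite hsl hlA pauliZ 1)
      (IndepOf.controlled hml.ne opS 1)).mono ?_
    intro i; fin_cases i <;> simp [Matrix.vecHead, Matrix.vecTail] <;> linarith
  have w₁ := Within.cnot hla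
  have w₂ := Within.cnot hla.symm
  set c₁ : Operator k := blockOp a fun y => if y l = 1 then pauliX else 1 with hc₁
  set c₂ : Operator k := blockOp l fun y => if y a = 1 then pauliX else 1 with hc₂
  set Q := blockOp l q with hQ
  set η : Operator k := blockOp a fun _ => hadamard with hη
  set ζ : Operator k := blockOp a fun y => if y l = 1 then pauliZ else 1 with hζ
  have ηη : η * η = 1 := by
    rw [hη, blockOp_mul (.const _ _), hadamard_mul_self, blockOp_one]
  have hηζ : η * ζ * η = c₁ := by
    have i := IndepOf.controlled hla.ne pauliZ 1
    rw [hη, hζ, blockOp_mul (.const _ _), blockOp_mul ((IndepOf.const _ _).comp₂ i (· * ·)), hc₁]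
    congr 1; funext y
    split_ifs
    · exact hadamard_pauliZ_hadamard
    · rw [mul_one, hadamard_mul_self]
  -- The controlled `Z` between `l` and `a` is symmetric, so it can be read as a gate on `l`, the
  -- qubit on which `Q` acts.
  have hζ' : ζ = blockOp l fun y => if y a = 1 then pauliZ else 1 := by
    have e₁ := mcz_insert (C := {l}) (t := a) (by simpa using hla.ne.symm)
    have e₂ := mcz_insert (C := {a}) (t := l) (by simpa using hla.ne)
    rw [Finset.pair_comm, e₁] at e₂
    simpa using e₂
  have hcomm : Q * η = η * Q := blockOp_comm hla.ne (iq a hma hsa haA) (.const _ _)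
  have hsign : ζ * Q * ζ * Q =
      blockOp a fun y => if ∀ j ∈ insert m A, y j = 1 then pauliZ else 1 := by
    have iz := IndepOf.controlled hla.symm.ne pauliZ 1
    have il := iq l hml.ne hsl hlA
    rw [hζ', hQ, blockOp_mul iz, blockOp_mul (iz.comp₂ il (· * ·)),
      blockOp_mul ((iz.comp₂ il (· * ·)).comp₂ iz (· * ·)), ← mcz_insert haS,
      ← blockOp_eq_mcz (a := l) (by simp [hlA, hla.ne, hml.ne.symm])]
    congr 1; funext y
    rw [hq]
    dsimp only
    rw [conj_smul, ← one_smul ℂ (if y a = 1 then pauliZ else 1),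
      smul_commutator (one_mul 1) (hs y), commutator_ite_pauliZ]
    exact if_congr (by rw [Finset.forall_mem_insert, Finset.forall_mem_insert]) rfl rfl
  have hN : c₁ * Q * c₁ * Q =
      blockOp a fun y => if ∀ j ∈ insert m A, y j = 1 then pauliX else 1 := by
    -- `H` on `a` turns `c₁` into `ζ` and commutes with `Q`, which neither acts on `a` nor depends
    -- on it.
    have : c₁ * Q * c₁ * Q = η * (ζ * Q * ζ * Q) * η := by
      calc c₁ * Q * c₁ * Q = η * ζ * (η * Q) * η * ζ * (η * Q) := by
            rw [← hηζ]; simp only [mul_assoc]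
        _ = η * ζ * Q * (η * η) * ζ * Q * η := by rw [← hcomm]; simp only [mul_assoc]
        _ = η * (ζ * Q * ζ * Q) * η := by rw [ηη, mul_one]; simp only [mul_assoc]
    have i := (IndepOf.forall_mem haS).ite pauliZ (1 : Matrix (Fin 2) (Fin 2) ℂ)
    rw [this, hsign, hη, blockOp_mul (.const _ _),
      blockOp_mul ((IndepOf.const _ _).comp₂ i (· * ·))]
    congr 1; funext y
    split_ifs
    · exact hadamard_pauliZ_hadamard
    · rw [mul_one, hadamard_mul_self]
  have hX : c₂ * c₁ * c₂ * c₁ * (c₁ * Q * c₁ * Q) * c₂ * c₁ =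
      blockOp l fun y => if ∀ j ∈ insert m A, y j = 1 then pauliX else 1 := by
    rw [hN, hc₁, hc₂]
    simp only [blockOp_eq_permOp, permOp_mul]
    simp only [Function.comp_assoc]
    rw [flip_comp_eq hla.ne (.forall_mem hlS) (.forall_mem haS)]
  have hc₁₁ : c₁ * c₁ = 1 := by
    rw [hc₁, blockOp_mul (IndepOf.controlled hla.ne pauliX 1), ← blockOp_one a]
    congr 1; funext y
    split_ifs
    · exact pauliX_mul_self
    · exact mul_one 1
  -- The adjacent factors `c₁ * c₁` are cancelled before the cost is counted.
  have hX' : c₂ * c₁ * c₂ * Q * c₁ * Q * c₂ * c₁ =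
      blockOp l fun y => if ∀ j ∈ insert m A, y j = 1 then pauliX else 1 := by
    rw [← hX]
    calc _ = c₂ * c₁ * c₂ * 1 * Q * c₁ * Q * c₂ * c₁ := by rw [mul_one]
      _ = _ := by rw [← hc₁₁]; simp only [mul_assoc]
  have w := ((((((w₂.mul w₁).mul w₂).mul wQ).mul w₁).mul wQ).mul w₂).mul w₁
  rw [hX'] at w
  refine ((w.hadamard_conj ((IndepOf.forall_mem hlS).ite _ _)).congr ?_).mono ?_
  · rw [mcz_insert hlS]
    congr 1; funext y
    split_ifs
    · exact hadamard_pauliX_hadamard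
    · rw [mul_one, hadamard_mul_self]
  · intro i; fin_cases i <;> simp [Matrix.vecHead, Matrix.vecTail] <;> linarith

/-! ### Placement of the controls and the target along paths -/

theorem cost_le_iff {x y z x' y' z' : ℤ} :
    (![x, y, z] : Cost) ≤ ![x', y', z'] ↔ x ≤ x' ∧ y ≤ y' ∧ z ≤ z' := by
  simp [Pi.le_def, Fin.forall_fin_succ]

/-- The neighbour `p (d - 1)` of the ancilla is left out, because the ladder uses it as its last
intermediate target; it is reinserted through the commutator. -/
theorem IsPath.hasLadder {p : ℕ → Fin k} {d : ℕ} (hp : IsPath p d) (hd : 2 ≤ d)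
    {A : Finset (Fin k)} (h0 : p 0 ∈ A) (hA : ∀ q ∈ A, ∃ j < d, p j = q) {m : ℤ}
    (hm : ((A.erase (p (d - 1))).card : ℤ) = m) :
    HasLadder (p d) (A.erase (p (d - 1))) ![2 * d + 4 * m - 5, 8 * m - 8, 4 * m - 2] := by
  subst hm
  have hnot : p d ∉ {q | ∃ j < d, p j = q} := by
    rintro ⟨j, hj, e⟩
    have := hp.2 j hj.le d le_rfl e; omega
  refine ⟨fun h => hnot (hA _ (Finset.mem_of_mem_erase h)), ?_⟩
  obtain ⟨s, hs, hdep, hW⟩ := exists_signedZ (by omega) hp (A.erase (p (d - 1)))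
    (Finset.mem_erase.2 ⟨fun e => by
      have := hp.2 0 (by omega) (d - 1) (by omega) e; omega, h0⟩) (fun q hq => by
      obtain ⟨hne, hqA⟩ := Finset.mem_erase.1 hq
      obtain ⟨j, hj, rfl⟩ := hA q hqA
      have : j ≠ d - 1 := fun e => hne (by rw [e])
      exact ⟨j, by omega, rfl⟩)
  exact ⟨s, hs, .of_dependsOn hdep hnot, hW⟩

theorem IsPath.adj_pred {p : ℕ → Fin k} {d : ℕ} (hp : IsPath p d) (hd : 1 ≤ d) :
    Adj (p (d - 1)) (p d) := by
  have := hp.1 (d - 1) (by omega)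
  rwa [show d - 1 + 1 = d by omega] at this

/-- All qubits of `S` lie on one side of the ancilla. -/
theorem within_mcz_of_path {p : ℕ → Fin k} {n : ℕ} (hn : 1 ≤ n) {S : Finset (Fin k)}
    (hS : S.card = n + 1) (h0 : p 0 ∈ S) (d : ℕ) (hp : IsPath p d)
    (hpS : ∀ q ∈ S, ∃ j < d, p j = q) :
    Within (mcz S) ![4 * d + 8 * n - 8, 16 * n - 16, 8 * n - 4] := by
  induction d with
  | zero =>
    obtain ⟨j, hj, -⟩ := hpS _ h0
    omega
  | succ d ih =>
    -- If the neighbour of the ancilla is in `S`, it provides the CNOT of the commutator. Otherwise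
    -- it is idle and can itself serve as the ancilla of a shorter path.
    by_cases hmem : p d ∈ S
    · have hd : 2 ≤ d + 1 := by
        by_contra hcon
        have : S ⊆ {p 0} := fun q hq => by
          obtain ⟨j, hj, rfl⟩ := hpS q hq
          rw [show j = 0 by omega, Finset.mem_singleton]
        have := Finset.card_le_card this
        rw [Finset.card_singleton] at this
        omega
      have hc : ((S.erase (p d)).card : ℤ) = n := by
        rw [Finset.card_erase_of_mem hmem, hS]; simp
      have := (hp.hasLadder hd h0 hpS hc).mcz_insert (hp.adj_pred (by omega))
      rw [Nat.add_sub_cancel, Finset.insert_erase hmem] at this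
      refine this.mono ?_
      intro i; fin_cases i <;> simp <;> linarith
    · refine (ih (hp.mono (by omega)) fun q hq => ?_).mono ?_
      · obtain ⟨j, hj, rfl⟩ := hpS q hq
        have : j ≠ d := fun e => hmem (e ▸ hq)
        exact ⟨j, by omega, rfl⟩
      · rw [cost_le_iff]; push_cast; omega

/-- All qubits of `S` lie on one side of the ancilla, except for one on the other side, adjacent
to the ancilla. -/
theorem within_mcz_of_path_insert {p : ℕ → Fin k} {n d : ℕ} {S : Finset (Fin k)} {r : Fin k}
    (hS : S.card = n + 1) (hp : IsPath p d) (hd : 2 ≤ d) (h0 : p 0 ∈ S)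
    (hpS : ∀ q ∈ S, q = r ∨ ∃ j < d, p j = q) (hr : r ∈ S) (hrp : ∀ j < d, p j ≠ r)
    (hadj : Adj r (p d)) :
    Within (mcz S) (if p (d - 1) ∈ S then ![4 * d + 8 * n - 12, 16 * n - 24, 8 * n - 8] else
      ![4 * d + 8 * n - 8, 16 * n - 16, 8 * n - 4]) := by
  have h0' : p 0 ∈ S.erase r := Finset.mem_erase.2 ⟨hrp 0 (by omega), h0⟩
  have hpS' : ∀ q ∈ S.erase r, ∃ j < d, p j = q := fun q hq =>
    (hpS q (Finset.mem_of_mem_erase hq)).resolve_left (Finset.ne_of_mem_erase hq)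
  have hc : (S.erase r).card = n := by rw [Finset.card_erase_of_mem hr, hS]; simp
  split_ifs with hmem
  · have hmem' : p (d - 1) ∈ S.erase r := Finset.mem_erase.2 ⟨hrp _ (by omega), hmem⟩
    have hc' : (((S.erase r).erase (p (d - 1))).card : ℤ) = n - 1 := by
      have := Finset.card_erase_add_one hmem'
      omega
    have := (hp.hasLadder hd h0' hpS' hc').mcz_insert_insert (hp.adj_pred (by omega)) hadj
    rw [Finset.insert_erase hmem', Finset.insert_erase hr] at this
    refine this.mono ?_
    intro i; fin_cases i <;> simp <;> linarith
  · have hmem' : p (d - 1) ∉ S.erase r := fun h => hmem (Finset.mem_of_mem_erase h)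
    have hc' : (((S.erase r).erase (p (d - 1))).card : ℤ) = n := by
      rw [Finset.erase_eq_of_notMem hmem', hc]
    have := (hp.hasLadder hd h0' hpS' hc').mcz_insert hadj
    rw [Finset.erase_eq_of_notMem hmem', Finset.insert_erase hr] at this
    refine this.mono ?_
    intro i; fin_cases i <;> simp <;> linarith

/-- There are qubits of `S` on both sides of the ancilla, not adjacent to it. -/
theorem within_mcz_of_paths {p q : ℕ → Fin k} {n d e : ℕ} {S : Finset (Fin k)}
    (hS : S.card = n + 1) (hp : IsPath p d) (hq : IsPath q e) (hd : 2 ≤ d) (he : 2 ≤ e)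
    (hpq : p d = q e) (hp0 : p 0 ∈ S) (hq0 : q 0 ∈ S)
    (hpS : ∀ x ∈ S, (∃ j < d, p j = x) ∨ ∃ j < e, q j = x) (hdis : ∀ i < d, ∀ j < e, p i ≠ q j) :
    Within (mcz S) (if p (d - 1) ∈ S ∨ q (e - 1) ∈ S then
      ![4 * (d + e) + 8 * n - 16, 16 * n - 24, 8 * n] else
      ![4 * (d + e) + 8 * n - 12, 16 * n - 16, 8 * n + 4]) := by
  classical
  set A := S.filter fun x => ∃ j < d, p j = x with hAdef
  set B := S.filter fun x => ∃ j < e, q j = x with hBdef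
  have hAB : A ∪ B = S := by
    ext x
    simp only [hAdef, hBdef, Finset.mem_union, Finset.mem_filter, ← and_or_left]
    exact ⟨And.left, fun h => ⟨h, hpS x h⟩⟩
  have hdisj : Disjoint A B := by
    rw [Finset.disjoint_left]
    intro x hxA hxB
    obtain ⟨i, hi, rfl⟩ := (Finset.mem_filter.1 hxA).2
    obtain ⟨j, hj, h⟩ := (Finset.mem_filter.1 hxB).2
    exact hdis i hi j hj h.symm
  have hcard : A.card + B.card = n + 1 := by
    rw [← Finset.card_union_of_disjoint hdisj, hAB, hS]
  have hpA : p 0 ∈ A := Finset.mem_filter.2 ⟨hp0, 0, by omega, rfl⟩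
  have hqB : q 0 ∈ B := Finset.mem_filter.2 ⟨hq0, 0, by omega, rfl⟩
  have hA : ∀ x ∈ A, ∃ j < d, p j = x := fun x hx => (Finset.mem_filter.1 hx).2
  have hB : ∀ x ∈ B, ∃ j < e, q j = x := fun x hx => (Finset.mem_filter.1 hx).2
  have hlA : p (d - 1) ∈ A ↔ p (d - 1) ∈ S :=
    ⟨fun h => (Finset.mem_filter.1 h).1, fun h => Finset.mem_filter.2 ⟨h, d - 1, by omega, rfl⟩⟩
  have hrB : q (e - 1) ∈ B ↔ q (e - 1) ∈ S :=
    ⟨fun h => (Finset.mem_filter.1 h).1, fun h => Finset.mem_filter.2 ⟨h, e - 1, by omega, rfl⟩⟩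
  have LA := hp.hasLadder hd hpA hA rfl
  have LB := hq.hasLadder he hqB hB rfl
  have hl := hp.adj_pred (by omega)
  have hr := hq.adj_pred (by omega)
  rw [← hpq] at LB hr
  -- Having one near qubit or two gives the same total: the second leaves its ladder, and the extra
  -- conjugations cost exactly what the shorter ladder saves.
  by_cases h1 : p (d - 1) ∈ S <;> by_cases h2 : q (e - 1) ∈ S
  · have c1 := Finset.card_erase_add_one (hlA.2 h1)
    have c2 := Finset.card_erase_add_one (hrB.2 h2)
    have := LA.mcz_insert_insert_union LB hl hr
    rw [← Finset.insert_union, Finset.insert_erase (hlA.2 h1), ← Finset.union_insert,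
      Finset.insert_erase (hrB.2 h2), hAB] at this
    refine this.mono ?_
    rw [if_pos (Or.inl h1)]
    intro i; fin_cases i <;> simp <;> omega
  · have c1 := Finset.card_erase_add_one (hlA.2 h1)
    have c2 := Finset.erase_eq_of_notMem (mt hrB.1 h2)
    rw [c2] at LB
    have := LA.mcz_insert_union LB hl
    rw [← Finset.insert_union, Finset.insert_erase (hlA.2 h1), hAB] at this
    refine this.mono ?_
    rw [if_pos (Or.inl h1)]
    intro i; fin_cases i <;> simp <;> omega
  · have c1 := Finset.erase_eq_of_notMem (mt hlA.1 h1)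
    have c2 := Finset.card_erase_add_one (hrB.2 h2)
    rw [c1] at LA
    have := LB.mcz_insert_union LA hr
    rw [← Finset.insert_union, Finset.insert_erase (hrB.2 h2), Finset.union_comm, hAB] at this
    refine this.mono ?_
    rw [if_pos (Or.inr h2)]
    intro i; fin_cases i <;> simp <;> omega
  · have c1 := Finset.erase_eq_of_notMem (mt hlA.1 h1)
    have c2 := Finset.erase_eq_of_notMem (mt hrB.1 h2)
    rw [c1] at LA
    rw [c2] at LB
    have := LA.mcz_union LB
    rw [hAB] at this
    refine this.mono ?_
    rw [if_neg (by tauto)]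
    intro i; fin_cases i <;> simp <;> omega

/-- The qubits of `S` are consecutive, and there is a further qubit next to them. -/
theorem within_mcz_of_consecutive {p : ℕ → Fin k} {n : ℕ} (hn : 1 ≤ n) {S : Finset (Fin k)}
    (hp : IsPath p (n + 1)) (hS : S = (Finset.range (n + 1)).image p) :
    Within (mcz S) ![12 * n - 8, 16 * n - 16, 8 * n - 2] := by
  obtain rfl | hn2 : n = 1 ∨ 2 ≤ n := by omega
  -- For `n = 1` no control would be left for the ladder, but `mcz S` is then a controlled `Z`
  -- between neighbours.
  · have h := hp.1 0 (by omega)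
    have e : mcz S = blockOp (p 1) fun y => if y (p 0) = 1 then pauliZ else 1 := by
      have := mcz_insert (C := {p 0}) (t := p 1) (by simpa using h.ne.symm)
      rw [show S = {p 1, p 0} by rw [hS]; ext; simp [Finset.range_add_one], this]
      simp
    rw [e]
    exact (Within.controlledZ h).mono (cost_le_iff.2 (by norm_num))
  · have hinj : Set.InjOn p (Finset.range (n - 1)) := fun i hi j hj h =>
      hp.2 i (by simp at hi; omega) j (by simp at hj; omega) h
    set A := (Finset.range (n - 1)).image p with hA
    have hAc : (A.card : ℤ) = n - 1 := by
      rw [hA, Finset.card_image_of_injOn hinj, Finset.card_range]; omega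
    have hAS : insert (p n) (insert (p (n - 1)) A) = S := by
      rw [hS, Finset.range_add_one, Finset.image_insert]
      congr 1
      rw [hA, ← Finset.image_insert]
      congr 1
      ext j; simp; omega
    have hnotA (i : ℕ) (hi : n - 1 ≤ i) (hi' : i ≤ n + 1) : p i ∉ A := by
      intro h
      obtain ⟨j, hj, e⟩ := Finset.mem_image.1 h
      rw [Finset.mem_range] at hj
      have := hp.2 j (by omega) i hi' e; omega
    have hnot (i : ℕ) (hi : n ≤ i) (hi' : i ≤ n + 1) : p i ∉ {q | ∃ j < n, p j = q} := by
      rintro ⟨j, hj, e⟩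
      have := hp.2 j (by omega) i hi' e; omega
    obtain ⟨s, hs, hdep, hW⟩ := exists_signedZ (by omega) (hp.mono (by omega : n ≤ n + 1)) A
      (Finset.mem_image.2 ⟨0, by simp; omega, rfl⟩) (fun q hq => by
        obtain ⟨j, hj, rfl⟩ := Finset.mem_image.1 hq
        rw [Finset.mem_range] at hj
        exact ⟨j, by omega, rfl⟩)
    have := within_mcz_of_end (hp.1 n (by omega)) ((hp.mono (by omega)).adj_pred (by omega))
      (fun e => by have := hp.2 _ (by omega) _ (by omega) e; omega) (hnotA n (by omega) (by omega))
      (hnotA (n + 1) (by omega) le_rfl) hs (.of_dependsOn hdep (hnot n le_rfl (by omega)))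
      (.of_dependsOn hdep (hnot (n + 1) (by omega) le_rfl)) hW
    rw [hAS] at this
    refine this.mono ?_
    intro i; fin_cases i <;> simp <;> omega

/-- A CNOT between qubits at distance two. -/
theorem within_mcx_of_adj_adj {c a t : Fin k} (hca : Adj c a) (hat : Adj a t) (hct : c ≠ t) :
    Within (mcx {c} t) ![4, 0, 0] := by
  have w₁ := Within.cnot hca
  have w₂ := Within.cnot hat
  refine ((((w₂.mul w₁).mul w₂).mul w₁).congr ?_).mono ?_
  · rw [mcx, multiControlled_eq_blockOp]
    simp only [Finset.mem_singleton, forall_eq, blockOp_eq_permOp, permOp_mul]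
    congr 1
    have key (u : Fin 2) [Decidable (u = 1)] : (if u = 1 then (1 : Fin 2) else 0) = u := by
      fin_cases u <;> simp
    funext y j
    have h₁ := hca.ne
    have h₂ := hat.ne
    by_cases hjt : j = t
    · subst hjt
      simp only [Function.comp, flip, Function.update_self, Function.update_of_ne h₁,
        Function.update_of_ne h₂, Function.update_of_ne hct, Function.update_of_ne h₂.symm, key]
      generalize y j = u
      generalize y a = v
      generalize y c = w
      revert u v w; decide
    · by_cases hja : j = a
      · subst hja
        simp only [Function.comp, flip, Function.update_self, Function.update_of_ne h₁,
          Function.update_of_ne h₂, Function.update_of_ne hct, Function.update_of_ne h₂.symm, key]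
        generalize y j = v
        generalize y c = w
        revert v w; decide
      · simp [flip, hjt, hja]
  · intro i; fin_cases i <;> simp

/-- The qubits below `f`, starting with `f`. -/
def upPath (f : Fin k) (i : ℕ) : Fin k := if h : (f : ℕ) + i < k then ⟨f + i, h⟩ else f

/-- The qubits above `f`, starting with `f`. -/
def downPath (f : Fin k) (i : ℕ) : Fin k := ⟨f - i, (Nat.sub_le _ _).trans_lt f.2⟩

theorem upPath_val {f : Fin k} {i : ℕ} (h : (f : ℕ) + i < k) : (upPath f i : ℕ) = f + i := by
  simp [upPath, h]

theorem downPath_val (f : Fin k) (i : ℕ) : (downPath f i : ℕ) = f - i := rfl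

theorem isPath_upPath {f : Fin k} {d : ℕ} (h : (f : ℕ) + d < k) : IsPath (upPath f) d := by
  refine ⟨fun i hi => Or.inl ?_, fun i hi j hj e => ?_⟩
  · rw [upPath_val (by omega), upPath_val (by omega)]; omega
  · have := congrArg Fin.val e
    rw [upPath_val (by omega), upPath_val (by omega)] at this; omega

theorem isPath_downPath {f : Fin k} {d : ℕ} (h : d ≤ f) : IsPath (downPath f) d := by
  refine ⟨fun i hi => Or.inr ?_, fun i hi j hj e => ?_⟩
  · rw [downPath_val, downPath_val]; omega
  · have := congrArg Fin.val e
    rw [downPath_val, downPath_val] at this; omega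

theorem numMinus_eq (S : Finset (Fin k)) (a : Fin k) :
    numMinus S a = if ∃ q ∈ S, (q : ℕ) + 1 = a then 1 else 0 := by
  rw [numMinus]
  split_ifs with h
  · obtain ⟨q, hq, e⟩ := h
    rw [Finset.card_eq_one]
    refine ⟨q, ?_⟩
    ext x
    simp only [Finset.mem_filter, Finset.mem_singleton]
    constructor
    · rintro ⟨-, hx⟩; exact Fin.ext (by omega)
    · rintro rfl; exact ⟨hq, e⟩
  · rw [Finset.card_eq_zero, Finset.filter_eq_empty_iff]
    exact fun q hq e => h ⟨q, hq, e⟩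

theorem numPlus_eq (S : Finset (Fin k)) (a : Fin k) :
    numPlus S a = if ∃ q ∈ S, (a : ℕ) + 1 = q then 1 else 0 := by
  rw [numPlus]
  split_ifs with h
  · obtain ⟨q, hq, e⟩ := h
    rw [Finset.card_eq_one]
    refine ⟨q, ?_⟩
    ext x
    simp only [Finset.mem_filter, Finset.mem_singleton]
    constructor
    · rintro ⟨-, hx⟩; exact Fin.ext (by omega)
    · rintro rfl; exact ⟨hq, e⟩
  · rw [Finset.card_eq_zero, Finset.filter_eq_empty_iff]
    exact fun q hq e => h ⟨q, hq, e⟩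

theorem numAbove_pos {S : Finset (Fin k)} {a : Fin k} :
    0 < numAbove S a ↔ ∃ q ∈ S, (q : ℕ) + 1 < a := by
  simp [numAbove, Finset.card_pos, Finset.Nonempty]

theorem numBelow_pos {S : Finset (Fin k)} {a : Fin k} :
    0 < numBelow S a ↔ ∃ q ∈ S, (a : ℕ) + 1 < q := by
  simp [numBelow, Finset.card_pos, Finset.Nonempty]

/-! ### The refined gate count -/

/-- The predicate `R` singles out the only position available beyond the ancilla. Keeping the path
and `R` abstract serves both orientations of the line; a qubit satisfying `R` leaves room for a path
shorter by one, which is the bound `d + 2 ≤ k`. -/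
theorem within_mcx_oneSided {n d : ℕ} (hn : 1 ≤ n) {C : Finset (Fin k)} {t : Fin k} (ht : t ∉ C)
    (hS : (insert t C).card = n + 1) {p : ℕ → Fin k} (hp : IsPath p d) (hd : 2 ≤ d)
    (hdk : d + 1 ≤ k) (h0 : p 0 ∈ insert t C) {R : Fin k → Prop}
    (huniq : ∀ x y, R x → R y → x = y)
    (hR : ∀ x ∈ insert t C, (R x ∧ (∀ j < d, p j ≠ x) ∧ Adj x (p d) ∧ d + 2 ≤ k) ∨
      ¬ R x ∧ ∃ j < d, p j = x) {far : Prop} (hfar : p (d - 1) ∈ insert t C ↔ far)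
    [Decidable far] [Decidable (∃ x ∈ insert t C, R x)] :
    Within (mcx C t) (costOneSided k n ((if ∃ x ∈ insert t C, R x then 1 else 0 : ℕ) : ℤ)
      ((if far then 1 else 0 : ℕ) : ℤ)) := by
  by_cases hmem : ∃ x ∈ insert t C, R x
  · obtain ⟨x, hxS, hxR⟩ := hmem
    obtain ⟨-, h1, h2, h3⟩ := (hR x hxS).resolve_right fun h => h.1 hxR
    refine ((within_mcz_of_path_insert hS hp hd h0 (fun q hq => ?_) hxS h1 h2).mcx ht).mono ?_
    · exact (hR q hq).imp (fun h => huniq q x h.1 hxR) And.right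
    · have hex : ∃ x ∈ insert t C, R x := ⟨x, hxS, hxR⟩
      simp only [hex, if_true]
      by_cases hf : far
      · rw [if_pos (hfar.2 hf), if_pos hf]
        intro i; fin_cases i <;> simp [costOneSided] <;> omega
      · rw [if_neg (mt hfar.1 hf), if_neg hf]
        intro i; fin_cases i <;> simp [costOneSided] <;> omega
  · refine ((within_mcz_of_path hn hS h0 d hp fun q hq => ?_).mcx ht).mono ?_
    · exact ((hR q hq).resolve_left fun h => hmem ⟨q, hq, h.1⟩).2
    · rw [if_neg hmem]
      split_ifs
      · intro i; fin_cases i <;> simp [costOneSided] <;> omega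
      · intro i; fin_cases i <;> simp [costOneSided] <;> omega

theorem within_mcx_refined {n : ℕ} (hn : 1 ≤ n) {C : Finset (Fin k)} (hC : C.card = n)
    {t : Fin k} (ht : t ∉ C) {a : Fin k} (ha : a ∉ insert t C) :
    Within (mcx C t) (refinedCost k n (numAbove (insert t C) a) (numBelow (insert t C) a)
      (numPlus (insert t C) a) (numMinus (insert t C) a)) := by
  have hS : (insert t C).card = n + 1 := by rw [Finset.card_insert_of_notMem ht, hC]
  have hne : ∀ q ∈ insert t C, (q : ℕ) ≠ a := fun q hq e => ha (Fin.ext e ▸ hq)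
  have hmin := fun q hq => Fin.le_def.1 ((insert t C).min'_le q hq)
  have hminS := (insert t C).min'_mem (Finset.insert_nonempty t C)
  have hmax := fun q hq => Fin.le_def.1 ((insert t C).le_max' q hq)
  have hmaxS := (insert t C).max'_mem (Finset.insert_nonempty t C)
  set f := (insert t C).min' (Finset.insert_nonempty t C)
  set g := (insert t C).max' (Finset.insert_nonempty t C)
  have hak := a.2
  have hgk := g.2
  have hmem (q x : Fin k) (h : (q : ℕ) = x) : q ∈ insert t C ↔ x ∈ insert t C := by
    rw [Fin.ext h]
  have hup (hfa : (f : ℕ) + 1 < a) :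
      upPath f (a - f - 1) ∈ insert t C ↔ ∃ q ∈ insert t C, (q : ℕ) + 1 = a := by
    have v := upPath_val (f := f) (i := a - f - 1) (by omega)
    exact ⟨fun h => ⟨_, h, by omega⟩, fun ⟨q, hq, e⟩ => (hmem _ q (by omega)).2 hq⟩
  have hdown (hga : (a : ℕ) + 1 < g) :
      downPath g (g - a - 1) ∈ insert t C ↔ ∃ q ∈ insert t C, (a : ℕ) + 1 = q := by
    have v := downPath_val g (g - a - 1)
    exact ⟨fun h => ⟨_, h, by omega⟩, fun ⟨q, hq, e⟩ => (hmem _ q (by omega)).2 hq⟩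
  have habove : 0 < numAbove (insert t C) a → (f : ℕ) + 1 < a := fun h => by
    obtain ⟨x, hx, hxa⟩ := numAbove_pos.1 h
    have := hmin x hx
    omega
  have hbelow : 0 < numBelow (insert t C) a → (a : ℕ) + 1 < g := fun h => by
    obtain ⟨x, hx, hxa⟩ := numBelow_pos.1 h
    have := hmax x hx
    omega
  rw [refinedCost, numPlus_eq, numMinus_eq]
  by_cases h1 : 0 < numAbove (insert t C) a <;> by_cases h2 : 0 < numBelow (insert t C) a
  · rw [if_pos ⟨h1, h2⟩]
    have hfa := habove h1
    have hga := hbelow h2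
    have hp := isPath_upPath (f := f) (d := a - f) (by omega)
    have hq := isPath_downPath (f := g) (d := g - a) (by omega)
    have vp (j : ℕ) (hj : j ≤ a - f) : (upPath f j : ℕ) = f + j := upPath_val (by omega)
    have w := (within_mcz_of_paths hS hp hq (by omega) (by omega)
      (Fin.ext (by rw [vp _ le_rfl, downPath_val]; omega))
      ((hmem _ f (by rw [vp 0 (by omega)]; rfl)).2 hminS)
      ((hmem _ g (by rw [downPath_val]; rfl)).2 hmaxS)
      (fun y hy => by
        have y1 := hmin y hy
        have y2 := hmax y hy
        have y3 := hne y hy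
        rcases lt_or_ge (y : ℕ) a with h | h
        · exact Or.inl ⟨y - f, by omega, Fin.ext (by rw [vp _ (by omega)]; omega)⟩
        · exact Or.inr ⟨g - y, by omega, Fin.ext (by rw [downPath_val]; omega)⟩)
      (fun i hi j hj e => by
        have := congrArg Fin.val e
        rw [vp i (by omega), downPath_val] at this
        omega)).mcx ht
    simp only [hup hfa, hdown hga] at w
    refine w.mono ?_
    by_cases c1 : ∃ q ∈ insert t C, (q : ℕ) + 1 = a <;>
      by_cases c2 : ∃ q ∈ insert t C, (a : ℕ) + 1 = q <;>
      simp only [c1, c2, if_true, if_false, or_true, or_false] <;>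
      intro i <;> fin_cases i <;> simp [costTwoSided] <;> omega
  · rw [if_neg (fun h => h2 h.2), if_pos h1]
    have hfa := habove h1
    have vp (j : ℕ) (hj : j ≤ a - f) : (upPath f j : ℕ) = f + j := upPath_val (by omega)
    refine within_mcx_oneSided hn ht hS (isPath_upPath (f := f) (d := a - f) (by omega))
      (by omega) (by omega) ((hmem _ f (by rw [vp 0 (by omega)]; rfl)).2 hminS)
      (fun x y hx hy => Fin.ext (by omega)) (fun y hy => ?_) (hup hfa)
    have y1 := hmin y hy
    have y3 := hne y hy
    have y4 : ¬ (a : ℕ) + 1 < y := fun h => h2 (numBelow_pos.2 ⟨y, hy, h⟩)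
    have y5 := y.2
    rcases lt_or_ge (y : ℕ) a with h | h
    · exact Or.inr ⟨by omega, y - f, by omega, Fin.ext (by rw [vp _ (by omega)]; omega)⟩
    · refine Or.inl ⟨by omega, fun j hj e => ?_, Or.inr ?_, by omega⟩
      · have := congrArg Fin.val e
        rw [vp _ hj.le] at this; omega
      · rw [vp _ le_rfl]; omega
  · rw [if_neg (fun h => h1 h.1), if_neg h1, if_pos h2]
    have hga := hbelow h2
    refine within_mcx_oneSided hn ht hS (isPath_downPath (f := g) (d := g - a) (by omega))
      (by omega) (by omega) ((hmem _ g (by rw [downPath_val]; rfl)).2 hmaxS)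
      (fun x y hx hy => Fin.ext (by omega)) (fun y hy => ?_) (hdown hga)
    have y1 := hmax y hy
    have y3 := hne y hy
    have y4 : ¬ (y : ℕ) + 1 < a := fun h => h1 (numAbove_pos.2 ⟨y, hy, h⟩)
    rcases lt_or_ge (a : ℕ) y with h | h
    · exact Or.inr ⟨by omega, g - y, by omega, Fin.ext (by rw [downPath_val]; omega)⟩
    · refine Or.inl ⟨by omega, fun j hj e => ?_, Or.inl ?_, by omega⟩
      · have := congrArg Fin.val e
        rw [downPath_val] at this; omega
      · rw [downPath_val]; omega
  -- Without far qubits, `S` consists of the two neighbours of the ancilla, so the gate is a CNOT at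
  -- distance two.
  · rw [if_neg (fun h => h1 h.1), if_neg h1, if_neg h2]
    have hadj : ∀ q ∈ insert t C, Adj q a := fun q hq => by
      have q1 := hne q hq
      have q2 : ¬ (q : ℕ) + 1 < a := fun h => h1 (numAbove_pos.2 ⟨q, hq, h⟩)
      have q3 : ¬ (a : ℕ) + 1 < q := fun h => h2 (numBelow_pos.2 ⟨q, hq, h⟩)
      unfold Adj; omega
    obtain ⟨c, hc⟩ : C.Nonempty := Finset.card_pos.1 (by omega)
    have hct : c ≠ t := fun e => ht (e ▸ hc)
    have hca := hadj c (Finset.mem_insert_of_mem hc)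
    have hta := hadj t (Finset.mem_insert_self t C)
    have hCc : C = {c} := by
      ext x
      rw [Finset.mem_singleton]
      refine ⟨fun hx => ?_, fun e => e ▸ hc⟩
      have hxt : x ≠ t := fun e => ht (e ▸ hx)
      have hxa := hadj x (Finset.mem_insert_of_mem hx)
      unfold Adj at hca hta hxa
      rw [ne_eq, Fin.ext_iff] at hct hxt
      exact Fin.ext (by omega)
    rw [hCc]
    exact within_mcx_of_adj_adj hca hta.symm hct

/-! ### The bound with a freely chosen ancilla -/

theorem within_mcx {n : ℕ} (hn : 1 ≤ n) (hk : n + 2 ≤ k) {C : Finset (Fin k)} (hC : C.card = n)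
    {t : Fin k} (ht : t ∉ C) :
    Within (mcx C t) ![4 * (k : ℤ) + 8 * n - 16, 16 * (n : ℤ) - 16, 8 * (n : ℤ) + 4] := by
  have hS : (insert t C).card = n + 1 := by rw [Finset.card_insert_of_notMem ht, hC]
  have hmin := fun q hq => Fin.le_def.1 ((insert t C).min'_le q hq)
  have hminS := (insert t C).min'_mem (Finset.insert_nonempty t C)
  have hmax := fun q hq => Fin.le_def.1 ((insert t C).le_max' q hq)
  have hmaxS := (insert t C).max'_mem (Finset.insert_nonempty t C)
  set f := (insert t C).min' (Finset.insert_nonempty t C)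
  set g := (insert t C).max' (Finset.insert_nonempty t C)
  have hfg := hmin g hmaxS
  have hgk := g.2
  by_cases hgap : ∃ i, (f : ℕ) < i ∧ i < g ∧ ∀ q ∈ insert t C, (q : ℕ) ≠ i
  · classical
    -- Taking the first gap guarantees that the upper neighbour of the ancilla is in `S`; this makes
    -- `s - p = 1` in the two-sided case and gives the saving needed in the others.
    obtain ⟨i, ⟨hi1, hi2, hi3⟩, hlast⟩ : ∃ i : ℕ, ((f : ℕ) < i ∧ i < g ∧
        ∀ q ∈ insert t C, (q : ℕ) ≠ i) ∧ ∀ m < i, ¬ ((f : ℕ) < m ∧ m < g ∧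
        ∀ q ∈ insert t C, (q : ℕ) ≠ m) :=
      ⟨Nat.find hgap, Nat.find_spec hgap, fun m hm => Nat.find_min hgap hm⟩
    have ha : (⟨i, by omega⟩ : Fin k) ∉ insert t C := fun h => hi3 _ h rfl
    have hminus : ∃ q ∈ insert t C, (q : ℕ) + 1 = ((⟨i, by omega⟩ : Fin k) : ℕ) := by
      rcases Nat.lt_or_ge f (i - 1) with h | h
      · by_contra hno
        refine hlast (i - 1) (by omega) ⟨h, by omega, fun q hq e => hno ⟨q, hq, ?_⟩⟩
        exact (congrArg (· + 1) e).trans (Nat.sub_add_cancel (by omega))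
      · exact ⟨f, hminS, by simp; omega⟩
    refine (within_mcx_refined hn hC ht ha).mono ?_
    have hright : 0 < numBelow (insert t C) ⟨i, by omega⟩ ∨
        ∃ q ∈ insert t C, ((⟨i, by omega⟩ : Fin k) : ℕ) + 1 = q := by
      rcases Nat.lt_or_ge (i + 1) g with h | h
      · exact Or.inl (numBelow_pos.2 ⟨g, hmaxS, h⟩)
      · exact Or.inr ⟨g, hmaxS, by simp; omega⟩
    rw [numMinus_eq, if_pos hminus, numPlus_eq, refinedCost]
    by_cases h2 : 0 < numBelow (insert t C) ⟨i, by omega⟩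
    · by_cases h1 : 0 < numAbove (insert t C) ⟨i, by omega⟩ <;>
        by_cases h3 : ∃ q ∈ insert t C, ((⟨i, by omega⟩ : Fin k) : ℕ) + 1 = q <;>
        simp only [h1, h2, h3, and_self, if_true, if_false, and_true] <;>
        intro j <;> fin_cases j <;> simp [costTwoSided, costOneSided] <;> omega
    · have h3 := hright.resolve_left h2
      by_cases h1 : 0 < numAbove (insert t C) ⟨i, by omega⟩ <;>
        simp only [h1, h2, h3, and_self, if_true, if_false, and_false] <;>
        intro j <;> fin_cases j <;> simp [costOneSided] <;> omega
  · push Not at hgap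
    have hcons : ∀ i : ℕ, (f : ℕ) ≤ i → i ≤ g → ∃ q ∈ insert t C, (q : ℕ) = i := by
      intro i h1 h2
      rcases h1.eq_or_lt with h1 | h1
      · exact ⟨f, hminS, h1⟩
      · rcases h2.eq_or_lt with h2 | h2
        · exact ⟨g, hmaxS, h2.symm⟩
        · exact hgap i h1 h2
    have himg : (insert t C).image Fin.val = Finset.Icc (f : ℕ) g := by
      ext i
      rw [Finset.mem_image, Finset.mem_Icc]
      exact ⟨fun ⟨q, hq, e⟩ => e ▸ ⟨hmin q hq, hmax q hq⟩, fun h => hcons i h.1 h.2⟩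
    -- As `S` fills an interval of `n + 1 < k` qubits, there is a free qubit just after `g` or just
    -- before `f`. The CNOT count `12 n - 8` equals the bound when `k = n + 2`.
    have hlen : (g : ℕ) = f + n := by
      have := congrArg Finset.card himg
      rw [Finset.card_image_of_injective _ Fin.val_injective, hS, Nat.card_Icc] at this
      omega
    have key (p : ℕ → Fin k) (hp : IsPath p (n + 1))
        (hpS : insert t C = (Finset.range (n + 1)).image p) :
        Within (mcx C t) ![4 * (k : ℤ) + 8 * n - 16, 16 * (n : ℤ) - 16, 8 * (n : ℤ) + 4] := by
      refine ((within_mcz_of_consecutive hn hp hpS).mcx ht).mono ?_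
      intro j; fin_cases j <;> simp <;> omega
    by_cases hg : (g : ℕ) + 1 < k
    · refine key (upPath f) (isPath_upPath (by omega)) ?_
      ext q
      rw [Finset.mem_image]
      constructor
      · intro hq
        have := hmin q hq
        have := hmax q hq
        exact ⟨q - f, by rw [Finset.mem_range]; omega, Fin.ext (by rw [upPath_val (by omega)]; omega)⟩
      · rintro ⟨j, hj, rfl⟩
        rw [Finset.mem_range] at hj
        have v := upPath_val (f := f) (i := j) (by omega)
        obtain ⟨q, hq, e⟩ := hcons (upPath f j) (by omega) (by omega)
        rwa [← Fin.ext e]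
    · refine key (downPath g) (isPath_downPath (by omega)) ?_
      ext q
      rw [Finset.mem_image]
      constructor
      · intro hq
        have := hmin q hq
        have := hmax q hq
        exact ⟨g - q, by rw [Finset.mem_range]; omega, Fin.ext (by rw [downPath_val]; omega)⟩
      · rintro ⟨j, hj, rfl⟩
        rw [Finset.mem_range] at hj
        have v := downPath_val g j
        obtain ⟨q, hq, e⟩ := hcons (downPath g j) (by omega) (by omega)
        rwa [← Fin.ext e]

end LNN

end

theorem mainTheorem1 (k n : ℕ) (hn : 1 ≤ n) (hk : n + 2 ≤ k)
    (C : Finset (Fin k)) (hC : C.card = n) (t : Fin k) (ht : t ∉ C)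
    (a : Fin k) (ha : a ∉ insert t C) :
    LNN.MCXWithin C t ![4 * (k : ℤ) + 8 * n - 16, 16 * (n : ℤ) - 16, 8 * (n : ℤ) + 4] ∧
    LNN.MCXWithin C t
      (LNN.refinedCost k n (LNN.numAbove (insert t C) a) (LNN.numBelow (insert t C) a)
        (LNN.numPlus (insert t C) a) (LNN.numMinus (insert t C) a)) :=
  ⟨LNN.within_mcx hn hk hC ht, LNN.within_mcx_refined hn hC ht ha⟩
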